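/- Let $\phi:\mathbb Z\to\mathbb C$ have finite support consisting of more than one point. Let $\phi^{(1)}=\phi$ and $\phi^{(n)}(x)=\sum_{y\in\mathbb Z}\phi^{(n-1)}(x-y)\phi(y)$ be its convolution powers, put $\hat\phi(\xi)=\sum_{x\in\mathbb Z}\phi(x)e^{ix\xi}$ for $\xi\in\mathbb R$, and assume that $\sup_{\xi}|\hat\phi(\xi)|=1$. Let $\Omega=\{\xi\in(-\pi,\pi]:|\hat\phi(\xi)|=1\}$. For $\xi_0\in\Omega$ let $\Gamma_{\xi_0}(\xi)=\log\bigl(\hat\phi(\xi+\xi_0)/\hat\phi(\xi_0)\bigr)$ (principal branch, $\xi$ near $0$), let $\alpha(\xi_0)=\operatorname{Im}\Gamma_{\xi_0}'(0)$ (the drift constant), let $m(\xi_0)$ (the order) be the least integer $k\ge 2$ with $\Gamma_{\xi_0}^{(k)}(0)\neq0$, and let $\beta(\xi_0)=-\Gamma_{\xi_0}^{(m(\xi_0))}(0)/m(\xi_0)!$. Let $m=\max_{\xi_0\in\Omega}m(\xi_0)$, and let $\xi_1,\dots,\xi_R$ be the distinct points of $\Omega$ with $m(\xi_q)=m$; write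 $\alpha_q=\alpha(\xi_q)$ and $\beta_q=\beta(\xi_q)$. These constants are well defined: $\Omega$ is finite and non-empty, and for every $\xi_0\in\Omega$ the order $m(\xi_0)\ge2$ exists, $\beta(\xi_0)\ne0$, $\operatorname{Re}\beta(\xi_0)\ge0$, $\operatorname{Re}\beta(\xi_0)=0$ if $m(\xi_0)$ is odd, and $\Gamma_{\xi_0}(\xi)=i\alpha(\xi_0)\xi-\beta(\xi_0)\xi^{m(\xi_0)}+o(\xi^{m(\xi_0)})$ as $\xi\to0$. For $q=1,\dots,R$ and $x\in\mathbb R$ the integral $$H_m^{\beta_q}(x)=\frac1{2\pi}\int_{\mathbb R}e^{-ixu}e^{-\beta_q u^m}\,du$$ converges as an improper Riemann integral. Finally, for every $q\in\{1,\dots,R\}$, $$\phi^{(n)}\bigl(\lfloor\alpha_qn+xn^{1/m}\rfloor\bigr)=\sum_{\substack{1\le j\le R\\ \alpha_j=\alpha_q}}n^{-1/m}e^{-i\lfloor\alpha_qn+xn^{1/m}\rfloor\xi_j}\,\hat\phi(\xi_j)^n\,H_m^{\beta_j}(x)+o(n^{-1/m})$$ as $n\to\infty$, uniformly for $x$ in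 any compact subset of $\mathbb R$. No further hypothesis is made; in particular the case in which $m=2$ and some $\beta_j$ are purely imaginary is included. -/

import Mathlib

open Filter Topology Set

noncomputable section

namespace ConvPowers

/-- The support of `φ : ℤ → ℂ` is admissible: it is finite and has more than one point. -/
def AdmissibleSupport (φ : ℤ → ℂ) : Prop :=
  (Function.support φ).Finite ∧ (Function.support φ).Nontrivial

/-- Convolution powers: the zeroth one is the unit mass at `0`, and
`φ⁽ⁿ⁺¹⁾(x) = ∑ y, φ⁽ⁿ⁾(x - y) φ(y)`; the first one is `φ`, see `convPow_one`. -/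
def convPow (φ : ℤ → ℂ) : ℕ → ℤ → ℂ
  | 0 => Pi.single 0 1
  | n + 1 => fun x => ∑' y : ℤ, convPow φ n (x - y) * φ y

theorem convPow_one (φ : ℤ → ℂ) : convPow φ 1 = φ := by
  funext x
  simp only [convPow]
  rw [tsum_eq_single x]
  · simp
  · intro y hy
    have h : x - y ≠ 0 := sub_ne_zero.mpr (Ne.symm hy)
    simp [Pi.single_eq_of_ne h]

/-- The Fourier transform `φ̂(ξ) = ∑ x, φ(x) e^{i x ξ}`. -/
def fourierT (φ : ℤ → ℂ) (ξ : ℝ) : ℂ :=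
  ∑' x : ℤ, φ x * Complex.exp (Complex.I * (x : ℂ) * (ξ : ℂ))

/-- The set `Ω` of points of `(-π, π]` at which `|ν| = 1`. -/
def unitPoints (ν : ℝ → ℂ) : Set ℝ :=
  {ξ | ξ ∈ Ioc (-Real.pi) Real.pi ∧ ‖ν ξ‖ = 1}

/-- `Γ(ξ) = log (ν(ξ + ξ₀) / ν(ξ₀))`, with the principal branch. -/
def localLog (ν : ℝ → ℂ) (ξ₀ : ℝ) (ξ : ℝ) : ℂ :=
  Complex.log (ν (ξ + ξ₀) / ν ξ₀)

/-- The drift constant `α(ξ₀)`: the Taylor series of `Γ` at `0` starts with `i α ξ`. -/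
def drift (ν : ℝ → ℂ) (ξ₀ : ℝ) : ℝ :=
  (deriv (localLog ν ξ₀) 0).im

/-- The order `m(ξ₀)`: the degree of the first non-vanishing term, of degree at least two, in the
Taylor series of `Γ` at `0`. -/
def order (ν : ℝ → ℂ) (ξ₀ : ℝ) : ℕ :=
  sInf {k : ℕ | 2 ≤ k ∧ iteratedDeriv k (localLog ν ξ₀) 0 ≠ 0}

/-- The constant `β(ξ₀)`: the term of degree `m = m(ξ₀)` in the Taylor series of `Γ` at `0` is
`-β ξ^m`. -/
def coeff (ν : ℝ → ℂ) (ξ₀ : ℝ) : ℂ :=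
  -(iteratedDeriv (order ν ξ₀) (localLog ν ξ₀) 0 / ((order ν ξ₀).factorial : ℂ))

/-- `m_φ`, the maximum of the orders of the points of `Ω`. -/
def maxOrder (ν : ℝ → ℂ) : ℕ :=
  sSup (order ν '' unitPoints ν)

/-- The points `ξ₁, …, ξ_R` of `Ω` whose order is the maximal one. -/
def maxPoints (ν : ℝ → ℂ) : Set ℝ :=
  {ξ | ξ ∈ unitPoints ν ∧ order ν ξ = maxOrder ν}

/-- The truncated integral `(1 / 2π) ∫_a^b e^{-ixu} e^{-β u^m} du`, as a function of `(a, b)`. -/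
def attractorTrunc (m : ℕ) (β : ℂ) (x : ℝ) (p : ℝ × ℝ) : ℂ :=
  (1 / (2 * (Real.pi : ℂ))) * ∫ u in p.1..p.2,
    Complex.exp (-(Complex.I * (x : ℂ) * (u : ℂ))) * Complex.exp (-(β * (u : ℂ) ^ m))

/-- The attractor `H_m^β(x) = (1 / 2π) ∫_ℝ e^{-ixu} e^{-β u^m} du`, an improper Riemann integral:
the limit of the integrals over `[a, b]` as `a → -∞` and `b → ∞` independently. -/
def attractor (m : ℕ) (β : ℂ) (x : ℝ) : ℂ :=
  limUnder (atBot ×ˢ atTop) (attractorTrunc m β x)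

end ConvPowers

end

/-! Fourier inversion writes `φ⁽ⁿ⁾(k)` as `1 / 2π` times the integral of `e^{-ikξ} φ̂(ξ)ⁿ` over a
period (`convPow_eq_integral`). Away from the finite set `Ω` the integrand is exponentially small.
Near `ξ₀ ∈ Ω` it is a unimodular constant times `exp (n Γ(ξ) - ikξ)`, and the substitution `ξ =
n^(-1/m) u` turns this formally into the integrand of `H_m^β`.

The difficulty is that `Re β` may vanish. Then the limiting integrand has modulus one and dominated
convergence is not available. What remains is `Re Γ ≤ 0`, a consequence of `|φ̂| ≤ 1`, and the fact
that `Γ''(ξ)` is close to `-m(m-1)β ξ^(m-2)`, so that on each side of `0` it stays in a sector.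
Projecting `Γ'` on the axis of that sector gives a monotone real function, and the van der Corput
estimates hold for such complex phases whatever the argument of `β`
(`norm_integral_cexp_le_of_first`, `norm_integral_cexp_le_of_second`).

For a point of order `m₀` and `η = n^(-1/m₀)` this yields three facts about the integral on one side
of the point. If the linear term matches the drift, it is `η` times the half-line limit up to
`o(η)`: `[0, Aη]` gives the limit and the rest is a small multiple of `η` for large `A`
(`IsOneSidedPhase.norm_integral_sub_le`). It is `O(η)` for every linear term, which discards the
orders below `m` (`IsOneSidedPhase.norm_integral_le`). It is `O(1/n)` if the drift differs
(`IsOneSidedPhase.norm_integral_le_of_drift`). The same tail estimate, for the phase `-β u^m`, makes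
the attractor integrals converge. The left side of a point is reduced to the right side by
reflection. -/

namespace ConvPowers

open MeasureTheory

noncomputable section

/-! ### Van der Corput estimates for complex phases. -/

section Oscillatory

variable {Ψ Ψ' Ψ'' : ℝ → ℂ} {a b : ℝ}

theorem norm_cexp_le_one {z : ℂ} (hz : z.re ≤ 0) : ‖Complex.exp z‖ ≤ 1 := by
  rw [Complex.norm_exp]
  exact Real.exp_le_one_iff.mpr hz

/-- Integration by parts for `∫ exp Ψ` with a complex phase of non-positive real part. -/
theorem norm_integral_cexp_le (hab : a ≤ b)
    (h1 : ∀ x ∈ Icc a b, HasDerivAt Ψ (Ψ' x) x)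
    (h2 : ∀ x ∈ Icc a b, HasDerivAt Ψ' (Ψ'' x) x)
    (hc : ContinuousOn Ψ'' (Icc a b)) (hre : ∀ x ∈ Icc a b, (Ψ x).re ≤ 0)
    (hne : ∀ x ∈ Icc a b, Ψ' x ≠ 0) :
    ‖∫ x in a..b, Complex.exp (Ψ x)‖ ≤
      1 / ‖Ψ' a‖ + 1 / ‖Ψ' b‖ + ∫ x in a..b, ‖Ψ'' x‖ / ‖Ψ' x‖ ^ 2 := by
  have cΨ : ContinuousOn Ψ (Icc a b) := fun x hx => (h1 x hx).continuousAt.continuousWithinAt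
  have cΨ' : ContinuousOn Ψ' (Icc a b) := fun x hx => (h2 x hx).continuousAt.continuousWithinAt
  have cE : ContinuousOn (fun x => Complex.exp (Ψ x)) (Icc a b) := cΨ.cexp
  have cR : ContinuousOn (fun x => Complex.exp (Ψ x) * Ψ'' x / Ψ' x ^ 2) (Icc a b) :=
    (cE.mul hc).div (cΨ'.pow 2) fun x hx => pow_ne_zero 2 (hne x hx)
  have cN : ContinuousOn (fun x => ‖Ψ'' x‖ / ‖Ψ' x‖ ^ 2) (Icc a b) :=
    hc.norm.div (cΨ'.norm.pow 2) fun x hx => pow_ne_zero 2 (norm_ne_zero_iff.mpr (hne x hx))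
  rw [← uIcc_of_le hab] at cE cR cN
  -- The primitive `exp Ψ / Ψ'` encodes the integration by parts of `(exp Ψ)' · (1 / Ψ')`.
  have hF : ∀ x ∈ uIcc a b, HasDerivAt (fun x => Complex.exp (Ψ x) / Ψ' x)
      (Complex.exp (Ψ x) - Complex.exp (Ψ x) * Ψ'' x / Ψ' x ^ 2) x := by
    intro x hx
    rw [uIcc_of_le hab] at hx
    have := ((h1 x hx).cexp).div (h2 x hx) (hne x hx)
    have hx0 := hne x hx
    exact this.congr_deriv (by field_simp)
  have hftc := intervalIntegral.integral_eq_sub_of_hasDerivAt hF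
    ((cE.sub cR).intervalIntegrable)
  rw [intervalIntegral.integral_sub cE.intervalIntegrable cR.intervalIntegrable] at hftc
  have hmain : ∫ x in a..b, Complex.exp (Ψ x) =
      Complex.exp (Ψ b) / Ψ' b - Complex.exp (Ψ a) / Ψ' a +
        ∫ x in a..b, Complex.exp (Ψ x) * Ψ'' x / Ψ' x ^ 2 := by
    rw [← hftc]; ring
  have hend : ∀ x ∈ Icc a b, ‖Complex.exp (Ψ x) / Ψ' x‖ ≤ 1 / ‖Ψ' x‖ := fun x hx => by
    rw [norm_div]
    exact div_le_div_of_nonneg_right (norm_cexp_le_one (hre x hx)) (norm_nonneg _)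
  have hint : ‖∫ x in a..b, Complex.exp (Ψ x) * Ψ'' x / Ψ' x ^ 2‖ ≤
      ∫ x in a..b, ‖Ψ'' x‖ / ‖Ψ' x‖ ^ 2 := by
    refine intervalIntegral.norm_integral_le_of_norm_le hab (ae_of_all _ fun x hx => ?_)
      cN.intervalIntegrable
    have hx' : x ∈ Icc a b := Ioc_subset_Icc_self hx
    rw [norm_div, norm_mul, norm_pow]
    exact div_le_div_of_nonneg_right
      (mul_le_of_le_one_left (norm_nonneg _) (norm_cexp_le_one (hre x hx'))) (by positivity)
  rw [hmain]
  calc _ ≤ ‖Complex.exp (Ψ b) / Ψ' b‖ + ‖Complex.exp (Ψ a) / Ψ' a‖ + _ :=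
        (norm_add_le _ _).trans (add_le_add_left (norm_sub_le _ _) _)
    _ ≤ _ := by
        linarith [hend a (left_mem_Icc.mpr hab), hend b (right_mem_Icc.mpr hab)]

theorem hasDerivAt_re_mul {f : ℝ → ℂ} {f' : ℂ} {x : ℝ} (ω : ℂ) (h : HasDerivAt f f' x) :
    HasDerivAt (fun y => (ω * f y).re) (ω * f').re x :=
  Complex.reCLM.hasFDerivAt.comp_hasDerivAt x (h.const_mul ω)

theorem abs_re_mul_le {ω : ℂ} (hω : ‖ω‖ ≤ 1) (z : ℂ) : |(ω * z).re| ≤ ‖z‖ :=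
  (Complex.abs_re_le_norm _).trans (by
    rw [norm_mul]; exact mul_le_of_le_one_left (norm_nonneg _) hω)

/-- First derivative test: the second derivative stays in a sector around `conj ω`. -/
theorem norm_integral_cexp_le_of_first {ω : ℂ} (hω : ‖ω‖ ≤ 1) {μ : ℝ} (hμ : 0 < μ) (hab : a ≤ b)
    (h1 : ∀ x ∈ Icc a b, HasDerivAt Ψ (Ψ' x) x)
    (h2 : ∀ x ∈ Icc a b, HasDerivAt Ψ' (Ψ'' x) x)
    (hc : ContinuousOn Ψ'' (Icc a b)) (hre : ∀ x ∈ Icc a b, (Ψ x).re ≤ 0)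
    (hsec : ∀ x ∈ Icc a b, ‖Ψ'' x‖ ≤ 2 * (ω * Ψ'' x).re)
    (hlow : ∀ x ∈ Icc a b, μ ≤ |(ω * Ψ' x).re|) :
    ‖∫ x in a..b, Complex.exp (Ψ x)‖ ≤ 6 / μ := by
  set h : ℝ → ℝ := fun x => (ω * Ψ' x).re with hh
  have hle : ∀ x, |h x| ≤ ‖Ψ' x‖ := fun x => abs_re_mul_le hω _
  have hμ' : ∀ x ∈ Icc a b, μ ≤ ‖Ψ' x‖ := fun x hx => (hlow x hx).trans (hle x)
  have hh0 : ∀ x ∈ Icc a b, h x ≠ 0 := fun x hx =>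
    abs_pos.mp (hμ.trans_le (hlow x hx))
  have hne : ∀ x ∈ Icc a b, Ψ' x ≠ 0 := fun x hx =>
    norm_pos_iff.mp (hμ.trans_le (hμ' x hx))
  have key := norm_integral_cexp_le hab h1 h2 hc hre hne
  have cΨ' : ContinuousOn Ψ' (Icc a b) := fun x hx => (h2 x hx).continuousAt.continuousWithinAt
  have cN : ContinuousOn (fun x => ‖Ψ'' x‖ / ‖Ψ' x‖ ^ 2) (Icc a b) :=
    hc.norm.div (cΨ'.norm.pow 2) fun x hx => pow_ne_zero 2 (norm_ne_zero_iff.mpr (hne x hx))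
  have hd : ∀ x ∈ Icc a b, HasDerivAt h (ω * Ψ'' x).re x := fun x hx =>
    hasDerivAt_re_mul ω (h2 x hx)
  have ch : ContinuousOn h (Icc a b) := fun x hx => (hd x hx).continuousAt.continuousWithinAt
  have ch' : ContinuousOn (fun x => (ω * Ψ'' x).re) (Icc a b) :=
    Complex.continuous_re.comp_continuousOn (continuousOn_const.mul hc)
  have cM : ContinuousOn (fun x => 2 * (ω * Ψ'' x).re / h x ^ 2) (Icc a b) :=
    (continuousOn_const.mul ch').div (ch.pow 2) fun x hx => pow_ne_zero 2 (hh0 x hx)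
  -- Here `h'` is at least half of `‖Ψ''‖` and `|h| ≤ ‖Ψ'‖`, so the integrand is dominated by `2 h'
  -- / h ^ 2`, the derivative of `-2 / h`. Each endpoint then costs `1 / μ + 2 / μ`, in total `6 /
  -- μ`.
  have hmono : ∫ x in a..b, ‖Ψ'' x‖ / ‖Ψ' x‖ ^ 2 ≤
      ∫ x in a..b, 2 * (ω * Ψ'' x).re / h x ^ 2 := by
    refine intervalIntegral.integral_mono_on hab
      (ContinuousOn.intervalIntegrable (by rwa [uIcc_of_le hab]))
      (ContinuousOn.intervalIntegrable (by rwa [uIcc_of_le hab])) fun x hx => ?_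
    have hp : 0 < h x ^ 2 := by have := hh0 x hx; positivity
    refine div_le_div₀ ((norm_nonneg _).trans (hsec x hx)) (hsec x hx) hp ?_
    rw [← sq_abs (h x)]
    exact pow_le_pow_left₀ (abs_nonneg _) (hle x) 2
  have hftc : ∫ x in a..b, 2 * (ω * Ψ'' x).re / h x ^ 2 = -2 / h b - -2 / h a := by
    refine intervalIntegral.integral_eq_sub_of_hasDerivAt (f := fun x => -2 / h x)
      (fun x hx => ?_) (ContinuousOn.intervalIntegrable (by rwa [uIcc_of_le hab]))
    rw [uIcc_of_le hab] at hx
    have := (hasDerivAt_const x (-2 : ℝ)).div (hd x hx) (hh0 x hx)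
    exact this.congr_deriv (by ring)
  have hinv : ∀ x ∈ Icc a b, |2 / h x| ≤ 2 / μ := fun x hx => by
    rw [abs_div, abs_two]
    exact div_le_div_of_nonneg_left zero_le_two hμ (hlow x hx)
  have hinv' : ∀ x ∈ Icc a b, 1 / ‖Ψ' x‖ ≤ 1 / μ := fun x hx =>
    div_le_div_of_nonneg_left zero_le_one hμ (hμ' x hx)
  have ha := left_mem_Icc.mpr hab
  have hb := right_mem_Icc.mpr hab
  have e1 := abs_le.mp (hinv a ha)
  have e2 := abs_le.mp (hinv b hb)
  have e3 := hinv' a ha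
  have e4 := hinv' b hb
  rw [hftc] at hmono
  have e5 : -2 / h b = -(2 / h b) := by ring
  have e6 : -2 / h a = -(2 / h a) := by ring
  have e7 : (6 : ℝ) / μ = 1 / μ + 1 / μ + 2 / μ + 2 / μ := by ring
  rw [e5, e6] at hmono
  linarith [e1.1, e1.2, e2.1, e2.2]

/-- A function whose derivative is at least `l` on an interval grows linearly away from some
point of the interval. -/
theorem exists_linear_growth {h h' : ℝ → ℝ} {l : ℝ} (hab : a ≤ b)
    (hd : ∀ x ∈ Icc a b, HasDerivAt h (h' x) x) (hlow : ∀ x ∈ Icc a b, l ≤ h' x) :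
    ∃ t ∈ Icc a b, ∀ x ∈ Icc a b, l * |x - t| ≤ |h x| := by
  have hc : ContinuousOn h (Icc a b) := fun x hx => (hd x hx).continuousAt.continuousWithinAt
  have hmv : ∀ x ∈ Icc a b, ∀ y ∈ Icc a b, x ≤ y → l * (y - x) ≤ h y - h x := by
    refine (convex_Icc a b).mul_sub_le_image_sub_of_le_deriv hc (fun x hx => ?_) fun x hx => ?_
    · exact (hd x (interior_subset hx)).differentiableAt.differentiableWithinAt
    · rw [(hd x (interior_subset hx)).deriv]
      exact hlow x (interior_subset hx)
  have ha := left_mem_Icc.mpr hab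
  have hb := right_mem_Icc.mpr hab
  -- As `t` serves a zero of `h` or, if `h` keeps its sign, the endpoint nearest to one.
  rcases le_total 0 (h a) with h0 | h0
  · refine ⟨a, ha, fun x hx => ?_⟩
    rw [abs_of_nonneg (sub_nonneg.mpr hx.1)]
    linarith [hmv a ha x hx hx.1, le_abs_self (h x)]
  rcases le_total (h b) 0 with h1 | h1
  · refine ⟨b, hb, fun x hx => ?_⟩
    rw [abs_sub_comm, abs_of_nonneg (sub_nonneg.mpr hx.2)]
    linarith [hmv x hx b hb hx.2, neg_le_abs (h x)]
  obtain ⟨t, ht, hzero⟩ := intermediate_value_Icc hab hc (⟨h0, h1⟩ : (0 : ℝ) ∈ Icc (h a) (h b))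
  refine ⟨t, ht, fun x hx => ?_⟩
  rcases le_total t x with htx | htx
  · rw [abs_of_nonneg (sub_nonneg.mpr htx)]
    linarith [hmv t ht x hx htx, le_abs_self (h x)]
  · rw [abs_sub_comm, abs_of_nonneg (sub_nonneg.mpr htx)]
    linarith [hmv x hx t ht htx, neg_le_abs (h x)]

theorem norm_integral_cexp_le_length (hab : a ≤ b) (hre : ∀ x ∈ Icc a b, (Ψ x).re ≤ 0) :
    ‖∫ x in a..b, Complex.exp (Ψ x)‖ ≤ b - a := by
  have := intervalIntegral.norm_integral_le_of_norm_le_const (a := a) (b := b) (C := 1)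
    (f := fun x => Complex.exp (Ψ x)) fun x hx => by
      rw [uIoc_of_le hab] at hx
      exact norm_cexp_le_one (hre x (Ioc_subset_Icc_self hx))
  rwa [one_mul, abs_of_nonneg (sub_nonneg.mpr hab)] at this

/-- Second derivative test of van der Corput, for a complex phase of non-positive real part. -/
theorem norm_integral_cexp_le_of_second {ω : ℂ} (hω : ‖ω‖ ≤ 1) {s : ℝ} (hs : 0 < s) (hab : a ≤ b)
    (h1 : ∀ x ∈ Icc a b, HasDerivAt Ψ (Ψ' x) x)
    (h2 : ∀ x ∈ Icc a b, HasDerivAt Ψ' (Ψ'' x) x)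
    (hc : ContinuousOn Ψ'' (Icc a b)) (hre : ∀ x ∈ Icc a b, (Ψ x).re ≤ 0)
    (hsec : ∀ x ∈ Icc a b, ‖Ψ'' x‖ ≤ 2 * (ω * Ψ'' x).re)
    (hlow : ∀ x ∈ Icc a b, s ^ 2 ≤ (ω * Ψ'' x).re) :
    ‖∫ x in a..b, Complex.exp (Ψ x)‖ ≤ 14 / s := by
  have hd : ∀ x ∈ Icc a b, HasDerivAt (fun x => (ω * Ψ' x).re) (ω * Ψ'' x).re x := fun x hx =>
    hasDerivAt_re_mul ω (h2 x hx)
  obtain ⟨t, ht, hgrow⟩ := exists_linear_growth hab hd hlow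
  have hr : 0 < 1 / s := by positivity
  have cE : ContinuousOn (fun x => Complex.exp (Ψ x)) (Icc a b) :=
    ContinuousOn.cexp fun x hx => (h1 x hx).continuousAt.continuousWithinAt
  have far : ∀ x ∈ Icc a b, 1 / s ≤ |x - t| → s ≤ |(ω * Ψ' x).re| := fun x hx hxt => by
    refine le_trans ?_ (hgrow x hx)
    calc s = s ^ 2 * (1 / s) := by field_simp
      _ ≤ _ := by gcongr
  have outer : ∀ c d : ℝ, a ≤ c → c ≤ d → d ≤ b → (∀ x ∈ Icc c d, 1 / s ≤ |x - t|) →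
      ‖∫ x in c..d, Complex.exp (Ψ x)‖ ≤ 6 / s := by
    intro c d hac hcd hdb hfar
    have hsub : Icc c d ⊆ Icc a b := Icc_subset_Icc hac hdb
    exact norm_integral_cexp_le_of_first hω hs hcd (fun x hx => h1 x (hsub hx))
      (fun x hx => h2 x (hsub hx)) (hc.mono hsub) (fun x hx => hre x (hsub hx))
      (fun x hx => hsec x (hsub hx)) fun x hx => far x (hsub hx) (hfar x hx)
  -- The window of radius `1 / s` about `t` is bounded by its length `2 / s`. Outside it the
  -- projected derivative is at least `s ^ 2 * (1 / s) = s`, so each of the two outer pieces costs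
  -- `6 / s`.
  set p := max a (t - 1 / s) with hp
  set q := min b (t + 1 / s) with hq
  have hap : a ≤ p := le_max_left _ _
  have hqb : q ≤ b := min_le_left _ _
  have hpt : p ≤ t := max_le ht.1 (by linarith)
  have htq : t ≤ q := le_min ht.2 (by linarith)
  have hpb : p ≤ b := hpt.trans ht.2
  have haq : a ≤ q := ht.1.trans htq
  have hint : ∀ c d : ℝ, a ≤ c → c ≤ d → d ≤ b →
      IntervalIntegrable (fun x => Complex.exp (Ψ x)) volume c d := fun c d h h' h'' =>
    ContinuousOn.intervalIntegrable (by
      rw [uIcc_of_le h']; exact cE.mono (Icc_subset_Icc h h''))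
  have b1 : ‖∫ x in a..p, Complex.exp (Ψ x)‖ ≤ 6 / s := by
    rcases le_total (t - 1 / s) a with h | h
    · rw [hp, max_eq_left h]
      simp only [intervalIntegral.integral_same, norm_zero]
      positivity
    · refine outer a p le_rfl hap hpb fun x hx => ?_
      have : x ≤ t - 1 / s := hx.2.trans_eq (max_eq_right h)
      rw [abs_sub_comm]
      exact le_trans (by linarith) (le_abs_self _)
  have b3 : ‖∫ x in q..b, Complex.exp (Ψ x)‖ ≤ 6 / s := by
    rcases le_total b (t + 1 / s) with h | h
    · rw [hq, min_eq_left h]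
      simp only [intervalIntegral.integral_same, norm_zero]
      positivity
    · refine outer q b haq hqb le_rfl fun x hx => ?_
      have : t + 1 / s ≤ x := (min_eq_right h).symm.trans_le hx.1
      exact le_trans (by linarith) (le_abs_self _)
  have b2 : ‖∫ x in p..q, Complex.exp (Ψ x)‖ ≤ 2 / s := by
    refine (norm_integral_cexp_le_length (hpt.trans htq) fun x hx =>
      hre x ⟨hap.trans hx.1, hx.2.trans hqb⟩).trans ?_
    have e1 : q ≤ t + 1 / s := min_le_right _ _
    have e2 : t - 1 / s ≤ p := le_max_right _ _
    have e3 : 2 / s = 1 / s + 1 / s := by ring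
    linarith
  rw [← intervalIntegral.integral_add_adjacent_intervals (hint a q le_rfl haq hqb)
      (hint q b haq hqb le_rfl),
    ← intervalIntegral.integral_add_adjacent_intervals (hint a p le_rfl hap hpb)
      (hint p q hap (hpt.trans htq) hqb)]
  refine (norm_add_le _ _).trans ((add_le_add_left (norm_add_le _ _) _).trans ?_)
  have e : 14 / s = 6 / s + 2 / s + 6 / s := by ring
  linarith

end Oscillatory

/-! ### One-sided phases: tail, uniform, non-stationary and central estimates. -/

theorem re_natCast_mul (n : ℕ) (z : ℂ) : ((n : ℂ) * z).re = n * z.re := by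
  simp

theorem norm_cexp_sub_cexp_le {z w : ℂ} (hw : w.re ≤ 0) (hzw : ‖z - w‖ ≤ 1) :
    ‖Complex.exp z - Complex.exp w‖ ≤ 2 * ‖z - w‖ := by
  have e : Complex.exp z - Complex.exp w = Complex.exp w * (Complex.exp (z - w) - 1) := by
    rw [mul_sub, ← Complex.exp_add, mul_one, add_sub_cancel]
  rw [e, norm_mul]
  exact (mul_le_of_le_one_left (norm_nonneg _) (norm_cexp_le_one hw)).trans
    (Complex.norm_exp_sub_one_le hzw)

/-- The limiting integrand. -/
def kernelFun (m : ℕ) (b : ℂ) (x u : ℝ) : ℂ :=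
  Complex.exp (-(Complex.I * (x : ℂ) * (u : ℂ))) * Complex.exp (-(b * (u : ℂ) ^ m))

theorem continuous_kernelFun (m : ℕ) (b : ℂ) (x : ℝ) : Continuous (kernelFun m b x) := by
  unfold kernelFun; fun_prop

/-- A phase on `[0, δ]` of the form `G ξ = i a ξ - b ξ ^ m + o(ξ ^ m)`, with quantitative control of
its first two derivatives in the direction `ω`. -/
structure IsOneSidedPhase (G G' G'' : ℝ → ℂ) (a : ℝ) (b ω : ℂ) (m : ℕ) (c δ : ℝ) : Prop where
  two_le : 2 ≤ m
  c_pos : 0 < c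
  δ_pos : 0 < δ
  norm_le : ‖ω‖ ≤ 1
  b_ne : b ≠ 0
  b_re : 0 ≤ b.re
  deriv_one : ∀ ξ ∈ Icc 0 δ, HasDerivAt G (G' ξ) ξ
  deriv_two : ∀ ξ ∈ Icc 0 δ, HasDerivAt G' (G'' ξ) ξ
  cont : ContinuousOn G'' (Icc 0 δ)
  re_le : ∀ ξ ∈ Icc 0 δ, (G ξ).re ≤ 0
  deriv_zero : G' 0 = Complex.I * a
  low_one : ∀ ξ ∈ Icc 0 δ, c * ξ ^ (m - 1) ≤ (ω * (G' ξ - Complex.I * a)).re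
  low_two : ∀ ξ ∈ Icc 0 δ, c * ξ ^ (m - 2) ≤ (ω * G'' ξ).re
  sector : ∀ ξ ∈ Icc 0 δ, ‖G'' ξ‖ ≤ 2 * (ω * G'' ξ).re
  asymp : ∀ ε > 0, ∃ r > 0, ∀ ξ ∈ Icc 0 r,
    ‖G ξ - (Complex.I * a * ξ - b * (ξ : ℂ) ^ m)‖ ≤ ε * ξ ^ m

namespace IsOneSidedPhase

variable {G G' G'' : ℝ → ℂ} {a : ℝ} {b ω : ℂ} {m : ℕ} {c δ : ℝ}

theorem mono (h : IsOneSidedPhase G G' G'' a b ω m c δ) {δ' : ℝ} (h0 : 0 < δ') (hle : δ' ≤ δ) :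
    IsOneSidedPhase G G' G'' a b ω m c δ' := by
  have hs : Icc 0 δ' ⊆ Icc 0 δ := Icc_subset_Icc_right hle
  exact ⟨h.two_le, h.c_pos, h0, h.norm_le, h.b_ne, h.b_re, fun x hx => h.deriv_one x (hs hx),
    fun x hx => h.deriv_two x (hs hx), h.cont.mono hs, fun x hx => h.re_le x (hs hx),
    h.deriv_zero, fun x hx => h.low_one x (hs hx), fun x hx => h.low_two x (hs hx),
    fun x hx => h.sector x (hs hx), h.asymp⟩

theorem hasDerivAt_phase (h : IsOneSidedPhase G G' G'' a b ω m c δ) (n : ℕ) (l : ℝ) {ξ : ℝ}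
    (hξ : ξ ∈ Icc 0 δ) : HasDerivAt (fun ξ : ℝ => (n : ℂ) * G ξ - Complex.I * l * ξ)
      ((n : ℂ) * G' ξ - Complex.I * l) ξ := by
  have h1 := (h.deriv_one ξ hξ).const_mul (n : ℂ)
  have h2 := (Complex.ofRealCLM.hasDerivAt (x := ξ)).const_mul (Complex.I * l)
  simpa using h1.fun_sub h2

theorem hasDerivAt_phase_deriv (h : IsOneSidedPhase G G' G'' a b ω m c δ) (n : ℕ) (l : ℝ) {ξ : ℝ}
    (hξ : ξ ∈ Icc 0 δ) : HasDerivAt (fun ξ : ℝ => (n : ℂ) * G' ξ - Complex.I * l)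
      ((n : ℂ) * G'' ξ) ξ :=
  ((h.deriv_two ξ hξ).const_mul (n : ℂ)).sub_const _

theorem phase_re_le (h : IsOneSidedPhase G G' G'' a b ω m c δ) (n : ℕ) (l : ℝ) {ξ : ℝ}
    (hξ : ξ ∈ Icc 0 δ) : ((n : ℂ) * G ξ - Complex.I * l * ξ).re ≤ 0 := by
  have := h.re_le ξ hξ
  simp
  exact mul_nonpos_of_nonneg_of_nonpos n.cast_nonneg this

theorem phase_sector (h : IsOneSidedPhase G G' G'' a b ω m c δ) (n : ℕ) {ξ : ℝ}
    (hξ : ξ ∈ Icc 0 δ) : ‖(n : ℂ) * G'' ξ‖ ≤ 2 * (ω * ((n : ℂ) * G'' ξ)).re := by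
  have e : (ω * ((n : ℂ) * G'' ξ)).re = n * (ω * G'' ξ).re := by
    rw [mul_left_comm, re_natCast_mul]
  rw [e, norm_mul, Complex.norm_natCast]
  have := mul_le_mul_of_nonneg_left (h.sector ξ hξ) (n.cast_nonneg (α := ℝ))
  linarith

theorem intervalIntegrable (h : IsOneSidedPhase G G' G'' a b ω m c δ) (n : ℕ) (l : ℝ) {p q : ℝ}
    (hp : p ∈ Icc 0 δ) (hq : q ∈ Icc 0 δ) :
    IntervalIntegrable (fun ξ : ℝ => Complex.exp ((n : ℂ) * G ξ - Complex.I * l * ξ))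
      volume p q :=
  ContinuousOn.intervalIntegrable (ContinuousOn.cexp fun _ hx =>
    (h.hasDerivAt_phase n l (uIcc_subset_Icc hp hq hx)).continuousAt.continuousWithinAt)

/-- Decay of the tail of the integral when the linear term is small. -/
theorem norm_integral_tail_le (h : IsOneSidedPhase G G' G'' a b ω m c δ) {n : ℕ} {l p q μ : ℝ}
    (hp : 0 ≤ p) (hpq : p ≤ q) (hq : q ≤ δ) (hμ : 0 < μ)
    (hlow : μ ≤ n * (c * p ^ (m - 1)) - |n * a - l|) :
    ‖∫ ξ in p..q, Complex.exp ((n : ℂ) * G ξ - Complex.I * l * ξ)‖ ≤ 6 / μ := by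
  have hs : Icc p q ⊆ Icc 0 δ := Icc_subset_Icc hp hq
  refine norm_integral_cexp_le_of_first h.norm_le hμ hpq
    (fun x hx => h.hasDerivAt_phase n l (hs hx)) (fun x hx => h.hasDerivAt_phase_deriv n l (hs hx))
    (continuousOn_const.mul (h.cont.mono hs)) (fun x hx => h.phase_re_le n l (hs hx))
    (fun x hx => h.phase_sector n (hs hx)) fun x hx => ?_
  -- The derivative splits into a part that grows along the sector and the constant mismatch `i (n a
  -- - l)`, which costs at most `|n a - l|`.
  have e : ω * ((n : ℂ) * G' x - Complex.I * l) =
      (n : ℂ) * (ω * (G' x - Complex.I * a)) + ω * (Complex.I * ((n * a - l : ℝ) : ℂ)) := by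
    push_cast; ring
  have e1 : |(ω * (Complex.I * ((n * a - l : ℝ) : ℂ))).re| ≤ |n * a - l| :=
    (abs_re_mul_le h.norm_le _).trans (by
      rw [norm_mul, Complex.norm_I, one_mul, Complex.norm_real, Real.norm_eq_abs])
  have e2 : n * (c * p ^ (m - 1)) ≤ n * (ω * (G' x - Complex.I * a)).re := by
    refine mul_le_mul_of_nonneg_left (le_trans ?_ (h.low_one x (hs hx))) n.cast_nonneg
    exact mul_le_mul_of_nonneg_left (pow_le_pow_left₀ hp hx.1 _) h.c_pos.le
  refine le_trans ?_ (le_abs_self _)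
  rw [e, Complex.add_re, re_natCast_mul]
  linarith [(abs_le.mp e1).1]

/-- Uniform bound of van der Corput type, for every linear term. -/
theorem norm_integral_le (h : IsOneSidedPhase G G' G'' a b ω m c δ) {n : ℕ} {η : ℝ} (hη : 0 < η)
    (hnη : n * η ^ m = 1) (l : ℝ) :
    ‖∫ ξ in (0 : ℝ)..δ, Complex.exp ((n : ℂ) * G ξ - Complex.I * l * ξ)‖ ≤
      (1 + 14 / √c) * η := by
  have hc : 0 < √c := Real.sqrt_pos.mpr h.c_pos
  have hδ := h.δ_pos
  rcases le_total δ η with hle | hle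
  · refine (norm_integral_cexp_le_length hδ.le fun x hx => h.phase_re_le n l hx).trans ?_
    have : 0 < 14 / √c * η := by positivity
    linarith
  have h0 : (0 : ℝ) ∈ Icc 0 δ := left_mem_Icc.mpr hδ.le
  have hm : η ∈ Icc 0 δ := ⟨hη.le, hle⟩
  have h1 : δ ∈ Icc 0 δ := right_mem_Icc.mpr hδ.le
  rw [← intervalIntegral.integral_add_adjacent_intervals (h.intervalIntegrable n l h0 hm)
    (h.intervalIntegrable n l hm h1)]
  have b1 := norm_integral_cexp_le_length hη.le
    (Ψ := fun ξ : ℝ => (n : ℂ) * G ξ - Complex.I * l * ξ) fun x hx =>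
      h.phase_re_le n l ⟨hx.1, hx.2.trans hle⟩
  have hs : Icc η δ ⊆ Icc 0 δ := Icc_subset_Icc_left hη.le
  -- Differentiating twice removes `l`, hence the uniformity. The value `s = √c / η` fits because `n
  -- * η ^ m = 1` gives `n c η ^ (m - 2) = c / η ^ 2`.
  have b2 := norm_integral_cexp_le_of_second h.norm_le (s := √c / η) (by positivity) hle
    (fun x hx => h.hasDerivAt_phase n l (hs hx)) (fun x hx => h.hasDerivAt_phase_deriv n l (hs hx))
    (continuousOn_const.mul (h.cont.mono hs)) (fun x hx => h.phase_re_le n l (hs hx))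
    (fun x hx => h.phase_sector n (hs hx)) fun x hx => by
      rw [mul_left_comm, re_natCast_mul, div_pow, Real.sq_sqrt h.c_pos.le]
      have hpow : η ^ m = η ^ (m - 2) * η ^ 2 := by
        rw [← pow_add, Nat.sub_add_cancel h.two_le]
      calc c / η ^ 2 = (n * η ^ m) * c / η ^ 2 := by rw [hnη, one_mul]
        _ = n * (c * η ^ (m - 2)) := by rw [hpow]; field_simp
        _ ≤ n * (c * x ^ (m - 2)) := by
          have := h.c_pos
          have := hx.1
          gcongr
        _ ≤ _ := by
          have := h.low_two x (hs hx)
          gcongr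
  refine (norm_add_le _ _).trans ((add_le_add b1 b2).trans (le_of_eq ?_))
  field_simp
  ring

/-- The integral is `O(1 / n)` when the linear term is non-stationary. -/
theorem norm_integral_le_of_drift (h : IsOneSidedPhase G G' G'' a b ω m c δ) {n : ℕ} (hn : 0 < n)
    {l κ M : ℝ} (hκ : 0 < κ) (hl : κ * n ≤ |n * a - l|)
    (hsmall : ∀ ξ ∈ Icc 0 δ, ‖G' ξ - Complex.I * a‖ ≤ κ / 2)
    (hM : ∀ ξ ∈ Icc 0 δ, ‖G'' ξ‖ ≤ M) :
    ‖∫ ξ in (0 : ℝ)..δ, Complex.exp ((n : ℂ) * G ξ - Complex.I * l * ξ)‖ ≤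
      (4 / κ + 4 * M * δ / κ ^ 2) / n := by
  have hδ := h.δ_pos
  have hn' : (0 : ℝ) < n := Nat.cast_pos.mpr hn
  -- The mismatch `κ n` exceeds the variation `n κ / 2` of `n G'`, so there is no stationary point.
  have hlow : ∀ ξ ∈ Icc 0 δ, κ / 2 * n ≤ ‖(n : ℂ) * G' ξ - Complex.I * l‖ := fun ξ hξ => by
    have e : Complex.I * ((n * a - l : ℝ) : ℂ) =
        ((n : ℂ) * G' ξ - Complex.I * l) - (n : ℂ) * (G' ξ - Complex.I * a) := by
      push_cast; ring
    have e1 : |n * a - l| = ‖Complex.I * ((n * a - l : ℝ) : ℂ)‖ := by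
      rw [norm_mul, Complex.norm_I, one_mul, Complex.norm_real, Real.norm_eq_abs]
    have e2 : ‖(n : ℂ) * (G' ξ - Complex.I * a)‖ ≤ n * (κ / 2) := by
      rw [norm_mul, Complex.norm_natCast]
      exact mul_le_mul_of_nonneg_left (hsmall ξ hξ) hn'.le
    have e3 := norm_sub_le ((n : ℂ) * G' ξ - Complex.I * l) ((n : ℂ) * (G' ξ - Complex.I * a))
    rw [← e, ← e1] at e3
    linarith
  have hpos : 0 < κ / 2 * n := by positivity
  have key := norm_integral_cexp_le hδ.le (fun x hx => h.hasDerivAt_phase n l hx)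
    (fun x hx => h.hasDerivAt_phase_deriv n l hx) (continuousOn_const.mul h.cont)
    (fun x hx => h.phase_re_le n l hx)
    (fun x hx => norm_pos_iff.mp (hpos.trans_le (hlow x hx)))
  have hend : ∀ ξ ∈ Icc 0 δ, 1 / ‖(n : ℂ) * G' ξ - Complex.I * l‖ ≤ 1 / (κ / 2 * n) :=
    fun ξ hξ => div_le_div_of_nonneg_left zero_le_one hpos (hlow ξ hξ)
  have hint : ∫ ξ in (0 : ℝ)..δ, ‖(n : ℂ) * G'' ξ‖ / ‖(n : ℂ) * G' ξ - Complex.I * l‖ ^ 2 ≤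
      n * M / (κ / 2 * n) ^ 2 * δ := by
    have := intervalIntegral.norm_integral_le_of_norm_le_const (a := 0) (b := δ)
      (C := n * M / (κ / 2 * n) ^ 2)
      (f := fun ξ => ‖(n : ℂ) * G'' ξ‖ / ‖(n : ℂ) * G' ξ - Complex.I * l‖ ^ 2) fun ξ hξ => by
        rw [uIoc_of_le hδ.le] at hξ
        have hξ' := Ioc_subset_Icc_self hξ
        rw [Real.norm_of_nonneg (by positivity), norm_mul, Complex.norm_natCast]
        have h1 := hM ξ hξ'
        have h2 := hlow ξ hξ'
        have h3 : 0 ≤ M := (norm_nonneg _).trans h1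
        gcongr
    rw [sub_zero, abs_of_pos hδ] at this
    exact (le_abs_self _).trans this
  refine key.trans ?_
  have e1 := hend 0 (left_mem_Icc.mpr hδ.le)
  have e2 := hend δ (right_mem_Icc.mpr hδ.le)
  have e3 : (4 / κ + 4 * M * δ / κ ^ 2) / n =
      1 / (κ / 2 * n) + 1 / (κ / 2 * n) + n * M / (κ / 2 * n) ^ 2 * δ := by
    field_simp; ring
  rw [e3]
  linarith

/-- On the natural scale `η = n ^ (-1 / m)` the integral converges to the limiting one. -/
theorem norm_integral_center_le (h : IsOneSidedPhase G G' G'' a b ω m c δ) {A ε : ℝ} (hA : 0 < A)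
    (hε : 0 < ε) : ∃ η₀ : ℝ, 0 < η₀ ∧ ∀ η ∈ Ioc 0 η₀, ∀ n : ℕ, n * η ^ m = 1 → ∀ x l : ℝ,
      |l - (n * a + x / η)| ≤ 1 → A * η ≤ δ ∧
      ‖(∫ ξ in (0 : ℝ)..A * η, Complex.exp ((n : ℂ) * G ξ - Complex.I * l * ξ)) -
        η * ∫ u in (0 : ℝ)..A, kernelFun m b x u‖ ≤ ε * η := by
  -- `t` bounds the difference of the two exponents: half of it pays for the `o(ξ ^ m)` remainder,
  -- half for the rounding of `l`. Exponentiating doubles it, which needs `t ≤ 1`, and integrating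
  -- over `[0, A]` gives `2 t A ≤ ε`.
  set t := min 1 (ε / (2 * A)) with ht
  have ht0 : 0 < t := by positivity
  obtain ⟨r, hr, hG⟩ := h.asymp (t / (2 * A ^ m)) (by positivity)
  have hδ := h.δ_pos
  refine ⟨min (min r δ / A) (t / (2 * A)), by positivity, fun η hη n hn x l hl => ?_⟩
  obtain ⟨hη0, hη1⟩ := hη
  have hη2 : A * η ≤ min r δ := by
    rw [mul_comm, ← le_div_iff₀ hA]; exact hη1.trans (min_le_left _ _)
  have hη3 : A * η ≤ t / 2 := by
    have : η ≤ t / (2 * A) := hη1.trans (min_le_right _ _)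
    rw [le_div_iff₀ (by positivity)] at this
    linarith
  have hAδ : A * η ≤ δ := hη2.trans (min_le_right _ _)
  refine ⟨hAδ, ?_⟩
  set f : ℝ → ℂ := fun ξ => Complex.exp ((n : ℂ) * G ξ - Complex.I * l * ξ) with hf
  have hcov : ∫ ξ in (0 : ℝ)..A * η, f ξ = η * ∫ u in (0 : ℝ)..A, f (η * u) := by
    have := intervalIntegral.integral_comp_mul_left (a := 0) (b := A) f hη0.ne'
    rw [mul_zero, mul_comm η A] at this
    rw [this, Complex.real_smul, Complex.ofReal_inv, mul_inv_cancel_left₀]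
    exact Complex.ofReal_ne_zero.mpr hη0.ne'
  have hmaps : ∀ u ∈ Icc 0 A, η * u ∈ Icc 0 δ := fun u hu =>
    ⟨mul_nonneg hη0.le hu.1, by nlinarith [hu.2]⟩
  have cf : ContinuousOn (fun u => f (η * u)) (Icc 0 A) := by
    refine ContinuousOn.comp (t := Icc 0 δ) (g := f) ?_ (by fun_prop) hmaps
    exact ContinuousOn.cexp fun x hx => (h.hasDerivAt_phase n l hx).continuousAt.continuousWithinAt
  rw [hcov, ← mul_sub, norm_mul, Complex.norm_real, Real.norm_of_nonneg hη0.le, mul_comm ε,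
    ← intervalIntegral.integral_sub
      (ContinuousOn.intervalIntegrable (by rwa [uIcc_of_le hA.le]))
      ((continuous_kernelFun m b x).intervalIntegrable _ _)]
  refine mul_le_mul_of_nonneg_left ?_ hη0.le
  have hbound : ∀ u ∈ uIoc 0 A, ‖f (η * u) - kernelFun m b x u‖ ≤ 2 * t := by
    intro u hu
    rw [uIoc_of_le hA.le] at hu
    have hu0 : 0 ≤ u := hu.1.le
    have hηu : η * u ≤ A * η := by nlinarith [hu.2]
    have hGu := hG (η * u) ⟨by positivity, hηu.trans (hη2.trans (min_le_left _ _))⟩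
    have hw : (-(Complex.I * x * u) + -(b * (u : ℂ) ^ m)).re ≤ 0 := by
      have : (b * (u : ℂ) ^ m).re = b.re * u ^ m := by
        rw [← Complex.ofReal_pow, Complex.re_mul_ofReal]
      rw [Complex.add_re, Complex.neg_re, Complex.neg_re, this]
      have h2 := mul_nonneg h.b_re (pow_nonneg hu0 m)
      simp
      exact h2
    have hdiff : ((n : ℂ) * G (η * u) - Complex.I * l * ((η * u : ℝ) : ℂ)) -
        (-(Complex.I * x * u) + -(b * (u : ℂ) ^ m)) =
        (n : ℂ) * (G (η * u) - (Complex.I * a * ((η * u : ℝ) : ℂ) - b * ((η * u : ℝ) : ℂ) ^ m)) -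
          Complex.I * (((l - (n * a + x / η)) * (η * u) : ℝ) : ℂ) := by
      have h1 : (n : ℂ) * (η : ℂ) ^ m = 1 := by exact_mod_cast hn
      have h2 : (η : ℂ) ≠ 0 := Complex.ofReal_ne_zero.mpr hη0.ne'
      push_cast
      rw [mul_pow]
      have h3 : Complex.I * ((l - (n * a + x / η)) * (η * u) : ℂ) =
          Complex.I * (l * (η * u) - n * a * (η * u) - x * u) := by
        field_simp
        ring
      rw [h3]
      linear_combination -b * (u : ℂ) ^ m * h1
    have hn1 : ‖(n : ℂ) * (G (η * u) - (Complex.I * a * ((η * u : ℝ) : ℂ) -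
        b * ((η * u : ℝ) : ℂ) ^ m))‖ ≤ t / 2 := by
      rw [norm_mul, Complex.norm_natCast]
      calc n * _ ≤ n * (t / (2 * A ^ m) * (η * u) ^ m) :=
            mul_le_mul_of_nonneg_left hGu n.cast_nonneg
        _ = (n * η ^ m) * (t / (2 * A ^ m) * u ^ m) := by rw [mul_pow]; ring
        _ ≤ t / (2 * A ^ m) * A ^ m := by
          rw [hn, one_mul]
          have := hu.2
          gcongr
        _ = t / 2 := by field_simp
    have hn2 : ‖Complex.I * (((l - (n * a + x / η)) * (η * u) : ℝ) : ℂ)‖ ≤ t / 2 := by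
      rw [norm_mul, Complex.norm_I, one_mul, Complex.norm_real, Real.norm_eq_abs, abs_mul,
        abs_of_nonneg (by positivity : 0 ≤ η * u)]
      have : |l - (n * a + x / η)| * (η * u) ≤ 1 * (η * u) :=
        mul_le_mul_of_nonneg_right hl (by positivity)
      linarith
    have hzw : ‖((n : ℂ) * G (η * u) - Complex.I * l * ((η * u : ℝ) : ℂ)) -
        (-(Complex.I * x * u) + -(b * (u : ℂ) ^ m))‖ ≤ t := by
      rw [hdiff]
      exact (norm_sub_le _ _).trans (by linarith)
    have := norm_cexp_sub_cexp_le hw (hzw.trans (min_le_left _ _))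
    rw [Complex.exp_add] at this
    exact this.trans (by linarith)
  refine (intervalIntegral.norm_integral_le_of_norm_le_const hbound).trans ?_
  rw [sub_zero, abs_of_pos hA]
  have : t * (2 * A) ≤ ε := by
    rw [← le_div_iff₀ (by positivity)]; exact min_le_right _ _
  linarith

end IsOneSidedPhase

/-! ### Convergence of the attractor integrals and one-sided asymptotics. -/

section HalfAttractor

variable {m : ℕ} {b : ℂ}

/-- The direction in which `-b` points to the positive real axis. -/
def sectorDir (b : ℂ) : ℂ := -((starRingEnd ℂ) b / (‖b‖ : ℂ))

theorem norm_sectorDir_le (b : ℂ) : ‖sectorDir b‖ ≤ 1 := by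
  rw [sectorDir, norm_neg, norm_div, RCLike.norm_conj, Complex.norm_real, norm_norm]
  exact div_self_le_one _

theorem sectorDir_mul_neg (hb : b ≠ 0) : sectorDir b * -b = (‖b‖ : ℂ) := by
  have h : (‖b‖ : ℂ) ≠ 0 := Complex.ofReal_ne_zero.mpr (norm_ne_zero_iff.mpr hb)
  rw [sectorDir, neg_mul_neg, div_mul_eq_mul_div, div_eq_iff h, mul_comm, Complex.mul_conj,
    Complex.normSq_eq_norm_sq]
  push_cast
  ring

/-- The limiting exponent is itself a phase of this kind, with drift `0`. With `n = 1` and `l = x`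
the tail estimate therefore applies to the attractor as well. -/
theorem isOneSidedPhase_monomial (hm : 2 ≤ m) (hb : b ≠ 0) (hre : 0 ≤ b.re) {δ : ℝ} (hδ : 0 < δ) :
    IsOneSidedPhase (fun u => -b * (u : ℂ) ^ m) (fun u => -b * (m * (u : ℂ) ^ (m - 1)))
      (fun u => -b * (m * (((m - 1 : ℕ) : ℂ) * (u : ℂ) ^ (m - 1 - 1)))) 0 b (sectorDir b) m
      ‖b‖ δ := by
  have hpow : ∀ (k : ℕ) (u : ℝ), HasDerivAt (fun u : ℝ => (u : ℂ) ^ k) (k * (u : ℂ) ^ (k - 1)) u :=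
    fun k u => (hasDerivAt_pow k (u : ℂ)).comp_ofReal
  have hm1 : (1 : ℝ) ≤ m := by exact_mod_cast (by lia : 1 ≤ m)
  have hm2 : (1 : ℝ) ≤ ((m - 1 : ℕ) : ℝ) := by exact_mod_cast (by lia : 1 ≤ m - 1)
  have hnb : 0 < ‖b‖ := norm_pos_iff.mpr hb
  have e2 : ∀ u : ℝ, (sectorDir b * (-b * (m * (((m - 1 : ℕ) : ℂ) * (u : ℂ) ^ (m - 1 - 1))))).re =
      ‖b‖ * (m * (((m - 1 : ℕ) : ℝ) * u ^ (m - 2))) := fun u => by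
    rw [← mul_assoc, sectorDir_mul_neg hb, Nat.sub_sub]
    norm_cast
  refine ⟨hm, hnb, hδ, norm_sectorDir_le b, hb, hre, fun u _ => (hpow m u).const_mul _,
    fun u _ => ((hpow (m - 1) u).const_mul _).const_mul _, by fun_prop, fun u hu => ?_, ?_,
    fun u hu => ?_, fun u hu => ?_, fun u hu => ?_, fun ε hε => ⟨1, one_pos, fun u hu => ?_⟩⟩
  · rw [← Complex.ofReal_pow, Complex.re_mul_ofReal, Complex.neg_re]
    have := mul_nonneg hre (pow_nonneg hu.1 m)
    linarith
  · have : m - 1 ≠ 0 := by lia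
    simp [this]
  · have : (sectorDir b * (-b * (m * (u : ℂ) ^ (m - 1)) - Complex.I * ((0 : ℝ) : ℂ))).re =
        ‖b‖ * (m * u ^ (m - 1)) := by
      rw [Complex.ofReal_zero, mul_zero, sub_zero, ← mul_assoc, sectorDir_mul_neg hb]
      norm_cast
    rw [this]
    have := pow_nonneg hu.1 (m - 1)
    exact mul_le_mul_of_nonneg_left (le_mul_of_one_le_left this hm1) hnb.le
  · rw [e2]
    have h0 := pow_nonneg hu.1 (m - 2)
    have h1 : u ^ (m - 2) ≤ ((m - 1 : ℕ) : ℝ) * u ^ (m - 2) := le_mul_of_one_le_left h0 hm2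
    exact mul_le_mul_of_nonneg_left (h1.trans (le_mul_of_one_le_left (h0.trans h1) hm1)) hnb.le
  · rw [e2]
    have h0 := pow_nonneg hu.1 (m - 2)
    have : ‖-b * (m * (((m - 1 : ℕ) : ℂ) * (u : ℂ) ^ (m - 1 - 1)))‖ =
        ‖b‖ * (m * (((m - 1 : ℕ) : ℝ) * u ^ (m - 2))) := by
      rw [norm_mul, norm_mul, norm_mul, norm_pow, norm_neg, Complex.norm_natCast,
        Complex.norm_natCast, Complex.norm_real, Real.norm_of_nonneg hu.1, Nat.sub_sub]
    rw [this]
    have : 0 ≤ ‖b‖ * (m * (((m - 1 : ℕ) : ℝ) * u ^ (m - 2))) := by positivity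
    linarith
  · have := pow_nonneg hu.1 m
    simp
    positivity

theorem norm_integral_kernelFun_le (hm : 2 ≤ m) (hb : b ≠ 0) (hre : 0 ≤ b.re) {x p q μ : ℝ}
    (hp : 0 < p) (hpq : p ≤ q) (hμ : 0 < μ) (hlow : μ ≤ ‖b‖ * p ^ (m - 1) - |x|) :
    ‖∫ u in p..q, kernelFun m b x u‖ ≤ 6 / μ := by
  have h := isOneSidedPhase_monomial hm hb hre (hp.trans_le hpq)
  have key := h.norm_integral_tail_le (n := 1) (l := x) hp.le hpq le_rfl hμ (by simpa using hlow)
  convert key using 4 with u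
  rw [kernelFun, ← Complex.exp_add]
  congr 1
  push_cast
  ring

theorem exists_le_linear_pow (hm : 2 ≤ m) {c : ℝ} (hc : 0 < c) (Y : ℝ) :
    ∃ A : ℝ, 1 ≤ A ∧ ∀ B, A ≤ B → Y ≤ c * B ^ (m - 1) := by
  refine ⟨max 1 (Y / c), le_max_left _ _, fun B hB => ?_⟩
  have h1 : 1 ≤ B := (le_max_left _ _).trans hB
  have h2 : Y / c ≤ B := (le_max_right _ _).trans hB
  rw [div_le_iff₀ hc, mul_comm] at h2
  exact h2.trans (mul_le_mul_of_nonneg_left (le_self_pow₀ h1 (by lia)) hc.le)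

/-- The integral of the limiting integrand over the half line. -/
def halfAttractor (m : ℕ) (b : ℂ) (x : ℝ) : ℂ :=
  limUnder atTop fun B : ℝ => ∫ u in (0 : ℝ)..B, kernelFun m b x u

/-- The Cauchy criterion holds by oscillation, since for `Re b = 0` the integrand has modulus one
and is not absolutely integrable. -/
theorem tendsto_halfAttractor (hm : 2 ≤ m) (hb : b ≠ 0) (hre : 0 ≤ b.re) (x : ℝ) :
    Tendsto (fun B : ℝ => ∫ u in (0 : ℝ)..B, kernelFun m b x u) atTop
      (𝓝 (halfAttractor m b x)) := by
  refine tendsto_nhds_limUnder (cauchySeq_tendsto_of_complete ?_)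
  refine Metric.cauchySeq_iff'.mpr fun ε hε => ?_
  -- With `μ = 7 / ε` the tail bound `6 / μ` is strictly below `ε`.
  obtain ⟨A, hA, hlow⟩ := exists_le_linear_pow hm (norm_pos_iff.mpr hb) (7 / ε + |x|)
  refine ⟨A, fun B hB => ?_⟩
  have hk := continuous_kernelFun m b x
  rw [dist_eq_norm, intervalIntegral.integral_interval_sub_left (hk.intervalIntegrable _ _)
    (hk.intervalIntegrable _ _)]
  have h7 : (0 : ℝ) < 7 / ε := by positivity
  refine (norm_integral_kernelFun_le hm hb hre (one_pos.trans_le hA) hB h7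
    (by linarith [hlow A le_rfl])).trans_lt ?_
  rw [div_div_eq_mul_div, div_lt_iff₀ (by norm_num)]
  linarith

theorem norm_integral_sub_halfAttractor_le (hm : 2 ≤ m) (hb : b ≠ 0) (hre : 0 ≤ b.re) {x A μ : ℝ}
    (hA : 0 < A) (hμ : 0 < μ) (hlow : μ ≤ ‖b‖ * A ^ (m - 1) - |x|) :
    ‖(∫ u in (0 : ℝ)..A, kernelFun m b x u) - halfAttractor m b x‖ ≤ 6 / μ := by
  rw [norm_sub_rev]
  have hk := continuous_kernelFun m b x
  refine le_of_tendsto ((tendsto_halfAttractor hm hb hre x).sub_const _).norm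
    ((eventually_ge_atTop A).mono fun B hB => ?_)
  rw [intervalIntegral.integral_interval_sub_left (hk.intervalIntegrable _ _)
    (hk.intervalIntegrable _ _)]
  exact norm_integral_kernelFun_le hm hb hre hA hB hμ hlow

/-- Asymptotics of the one-sided integral, uniformly in the linear term on the natural scale. -/
theorem IsOneSidedPhase.norm_integral_sub_le {G G' G'' : ℝ → ℂ} {a : ℝ} {ω : ℂ} {c δ : ℝ}
    (h : IsOneSidedPhase G G' G'' a b ω m c δ) (X : ℝ) {ε : ℝ} (hε : 0 < ε) :
    ∃ η₀ : ℝ, 0 < η₀ ∧ ∀ η ∈ Ioc 0 η₀, ∀ n : ℕ, n * η ^ m = 1 → ∀ x l : ℝ, |x| ≤ X →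
      |l - (n * a + x / η)| ≤ 1 →
      ‖(∫ ξ in (0 : ℝ)..δ, Complex.exp ((n : ℂ) * G ξ - Complex.I * l * ξ)) -
        η * halfAttractor m b x‖ ≤ ε * η := by
  have hnb : 0 < ‖b‖ := norm_pos_iff.mpr h.b_ne
  -- There are three errors: the centre, the tail beyond `A * η`, and the tail of the limit beyond
  -- `A`. Each gets `ε / 3 = 6 / (18 / ε)`. The extra `1` absorbs the rounding of `l`, as `1 ≤ 1 /
  -- η`.
  obtain ⟨A₁, hA₁, hlow₁⟩ := exists_le_linear_pow h.two_le h.c_pos (18 / ε + X + 1)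
  obtain ⟨A₂, hA₂, hlow₂⟩ := exists_le_linear_pow h.two_le hnb (18 / ε + X)
  set A := max A₁ A₂
  have hA0 : 0 < A := one_pos.trans_le (hA₁.trans (le_max_left _ _))
  have hcA : 18 / ε + X + 1 ≤ c * A ^ (m - 1) := hlow₁ A (le_max_left _ _)
  have hbA : 18 / ε + X ≤ ‖b‖ * A ^ (m - 1) := hlow₂ A (le_max_right _ _)
  obtain ⟨η₀, hη₀, hcenter⟩ := h.norm_integral_center_le hA0 (by positivity : 0 < ε / 3)
  refine ⟨min η₀ 1, by positivity, fun η hη n hn x l hx hl => ?_⟩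
  have hη0 : 0 < η := hη.1
  have hη1 : η ≤ 1 := hη.2.trans (min_le_right _ _)
  obtain ⟨hAδ, hcen⟩ := hcenter η ⟨hη0, hη.2.trans (min_le_left _ _)⟩ n hn x l hl
  have h18 : 0 < 18 / ε := by positivity
  have hAη : 0 < A * η := by positivity
  have htail : ‖∫ ξ in A * η..δ, Complex.exp ((n : ℂ) * G ξ - Complex.I * l * ξ)‖ ≤
      ε / 3 * η := by
    have hμ : 0 < 18 / ε / η := by positivity
    refine (h.norm_integral_tail_le hAη.le hAδ le_rfl hμ ?_).trans (le_of_eq ?_)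
    · have e1 : n * (c * (A * η) ^ (m - 1)) = c * A ^ (m - 1) / η := by
        have : η ^ m = η ^ (m - 1) * η := by
          rw [← pow_succ, Nat.sub_add_cancel (by linarith [h.two_le])]
        rw [eq_div_iff hη0.ne', mul_pow]
        calc _ = n * (η ^ (m - 1) * η) * (c * A ^ (m - 1)) := by ring
          _ = _ := by rw [← this, hn, one_mul]
      have e2 : |n * a - l| ≤ (X + 1) / η := by
        have : n * a - l = -(x / η) - (l - (n * a + x / η)) := by ring
        rw [this]
        refine (abs_sub _ _).trans ?_
        rw [abs_neg, abs_div, abs_of_pos hη0, add_div]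
        have h1 : 1 ≤ 1 / η := (one_le_div hη0).mpr hη1
        have h2 : |x| / η ≤ X / η := div_le_div_of_nonneg_right hx hη0.le
        linarith
      rw [e1]
      have : 18 / ε / η ≤ (c * A ^ (m - 1) - (X + 1)) / η :=
        div_le_div_of_nonneg_right (by linarith) hη0.le
      rw [sub_div] at this
      linarith
    · field_simp
      norm_num
  have hlim : ‖(∫ u in (0 : ℝ)..A, kernelFun m b x u) - halfAttractor m b x‖ ≤ ε / 3 := by
    refine (norm_integral_sub_halfAttractor_le h.two_le h.b_ne h.b_re hA0 h18
      (x := x) (by linarith)).trans (le_of_eq ?_)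
    field_simp
    norm_num
  have hmemA : A * η ∈ Icc 0 δ := ⟨hAη.le, hAδ⟩
  rw [← intervalIntegral.integral_add_adjacent_intervals
    (h.intervalIntegrable n l (left_mem_Icc.mpr h.δ_pos.le) hmemA)
    (h.intervalIntegrable n l hmemA (right_mem_Icc.mpr h.δ_pos.le))]
  have hlim' : ‖(η : ℂ) * ((∫ u in (0 : ℝ)..A, kernelFun m b x u) - halfAttractor m b x)‖ ≤
      ε / 3 * η := by
    rw [norm_mul, Complex.norm_real, Real.norm_of_nonneg hη0.le, mul_comm]
    exact mul_le_mul_of_nonneg_right hlim hη0.le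
  have e : ∀ I₁ I₂ K H : ℂ, I₁ + I₂ - η * H = (I₁ - η * K) + I₂ + η * (K - H) := fun _ _ _ _ => by
    ring
  rw [e _ _ (∫ u in (0 : ℝ)..A, kernelFun m b x u)]
  refine (norm_add_le _ _).trans ((add_le_add_left (norm_add_le _ _) _).trans ?_)
  linarith

/-- Reflection carries the left half line to the right one, at the price of the factor `(-1) ^ m` on
`b`. Both half lines need a non-negative real part, which for odd `m` forces `Re b = 0`. -/
theorem kernelFun_neg (m : ℕ) (b : ℂ) (x u : ℝ) :
    kernelFun m b x (-u) = kernelFun m ((-1) ^ m * b) (-x) u := by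
  unfold kernelFun
  push_cast
  rw [neg_pow (u : ℂ)]
  ring_nf

theorem tendsto_attractorTrunc (hm : 2 ≤ m) (hb : b ≠ 0) (hre : 0 ≤ b.re)
    (hre' : 0 ≤ ((-1) ^ m * b).re) (x : ℝ) :
    Tendsto (attractorTrunc m b x) (atBot ×ˢ atTop)
      (𝓝 (1 / (2 * (Real.pi : ℂ)) *
        (halfAttractor m b x + halfAttractor m ((-1) ^ m * b) (-x)))) := by
  have hb' : (-1) ^ m * b ≠ 0 := mul_ne_zero (pow_ne_zero _ (by norm_num)) hb
  have h1 := (tendsto_halfAttractor hm hb hre x).comp (tendsto_snd (f := atBot (α := ℝ)))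
  have h2 := ((tendsto_halfAttractor hm hb' hre' (-x)).comp tendsto_neg_atBot_atTop).comp
    (tendsto_fst (g := atTop (α := ℝ)))
  refine ((h1.add h2).const_mul _).congr fun p => ?_
  have hk := continuous_kernelFun m b x
  have e : ∫ u in (0 : ℝ)..-p.1, kernelFun m ((-1) ^ m * b) (-x) u =
      ∫ u in p.1..0, kernelFun m b x u := by
    simp_rw [← kernelFun_neg]
    rw [intervalIntegral.integral_comp_neg]
    simp
  simp only [Function.comp_apply]
  rw [e, add_comm, intervalIntegral.integral_add_adjacent_intervals (hk.intervalIntegrable _ _)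
    (hk.intervalIntegrable _ _)]
  rfl

theorem attractor_eq (hm : 2 ≤ m) (hb : b ≠ 0) (hre : 0 ≤ b.re)
    (hre' : 0 ≤ ((-1) ^ m * b).re) (x : ℝ) :
    attractor m b x = 1 / (2 * (Real.pi : ℂ)) *
        (halfAttractor m b x + halfAttractor m ((-1) ^ m * b) (-x)) :=
  (tendsto_attractorTrunc hm hb hre hre' x).limUnder_eq

end HalfAttractor

/-! ### Fourier inversion and the set `Ω`. -/

section Fourier

variable {φ : ℤ → ℂ}

theorem fourierT_eq_sum (hφ : (Function.support φ).Finite) (ξ : ℝ) :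
    fourierT φ ξ = ∑ x ∈ hφ.toFinset, φ x * Complex.exp (Complex.I * (x : ℂ) * (ξ : ℂ)) := by
  refine tsum_eq_sum fun x hx => ?_
  rw [Finite.mem_toFinset, Function.notMem_support] at hx
  rw [hx, zero_mul]

theorem analyticAt_fourierT (hφ : (Function.support φ).Finite) (ξ : ℝ) :
    AnalyticAt ℝ (fourierT φ) ξ := by
  have h : AnalyticAt ℂ (fun z : ℂ => ∑ x ∈ hφ.toFinset,
      φ x * Complex.exp (Complex.I * (x : ℂ) * z)) (ξ : ℂ) :=
    Differentiable.analyticAt (by fun_prop) _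
  have h2 := AnalyticAt.comp (h.restrictScalars (𝕜 := ℝ)) (Complex.ofRealCLM.analyticAt ξ)
  refine h2.congr (Eventually.of_forall fun x => ?_)
  simp [fourierT_eq_sum hφ]

theorem continuous_fourierT (hφ : (Function.support φ).Finite) : Continuous (fourierT φ) :=
  continuous_iff_continuousAt.mpr fun ξ => (analyticAt_fourierT hφ ξ).continuousAt

theorem exp_int_mul_add_two_pi (k : ℤ) (ξ : ℝ) :
    Complex.exp (Complex.I * (k : ℂ) * ((ξ + 2 * Real.pi : ℝ) : ℂ)) =
      Complex.exp (Complex.I * (k : ℂ) * (ξ : ℂ)) := by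
  rw [Complex.exp_eq_exp_iff_exists_int]
  exact ⟨k, by push_cast; ring⟩

theorem periodic_fourierT (φ : ℤ → ℂ) : Function.Periodic (fourierT φ) (2 * Real.pi) := by
  intro ξ
  simp only [fourierT, exp_int_mul_add_two_pi]

theorem integral_exp_int (k : ℤ) :
    ∫ ξ in (-Real.pi)..Real.pi, Complex.exp (Complex.I * (k : ℂ) * (ξ : ℂ)) =
      if k = 0 then 2 * (Real.pi : ℂ) else 0 := by
  split_ifs with h
  · subst h
    simp
    ring
  · rw [integral_exp_mul_complex (mul_ne_zero Complex.I_ne_zero (Int.cast_ne_zero.mpr h))]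
    have := exp_int_mul_add_two_pi k (-Real.pi)
    rw [show -Real.pi + 2 * Real.pi = Real.pi by ring] at this
    rw [this, sub_self, zero_div]

/-- Fourier inversion for convolution powers. -/
theorem convPow_eq_integral (hφ : (Function.support φ).Finite) (n : ℕ) (k : ℤ) :
    convPow φ n k = 1 / (2 * (Real.pi : ℂ)) * ∫ ξ in (-Real.pi)..Real.pi,
      Complex.exp (-(Complex.I * (k : ℂ) * (ξ : ℂ))) * fourierT φ ξ ^ n := by
  have hpi : (2 * (Real.pi : ℂ)) ≠ 0 := by
    simp [Real.pi_ne_zero]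
  induction n generalizing k with
  | zero =>
    have e : ∀ ξ : ℝ, Complex.exp (-(Complex.I * (k : ℂ) * (ξ : ℂ))) * fourierT φ ξ ^ 0 =
        Complex.exp (Complex.I * ((-k : ℤ) : ℂ) * (ξ : ℂ)) := fun ξ => by
      rw [pow_zero, mul_one]; push_cast; ring_nf
    simp_rw [e]
    rw [integral_exp_int]
    simp only [convPow, Pi.single_apply, neg_eq_zero]
    split_ifs
    · field_simp
    · simp
  | succ n ih =>
    have hc := continuous_fourierT hφ
    have e : ∀ ξ : ℝ, Complex.exp (-(Complex.I * (k : ℂ) * (ξ : ℂ))) * fourierT φ ξ ^ (n + 1) =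
        ∑ y ∈ hφ.toFinset, φ y *
          (Complex.exp (-(Complex.I * ((k - y : ℤ) : ℂ) * (ξ : ℂ))) * fourierT φ ξ ^ n) :=
      fun ξ => by
        rw [pow_succ]
        nth_rewrite 2 [fourierT_eq_sum hφ]
        rw [← mul_assoc, Finset.mul_sum]
        refine Finset.sum_congr rfl fun y _ => ?_
        have : -(Complex.I * ((k - y : ℤ) : ℂ) * (ξ : ℂ)) =
            -(Complex.I * (k : ℂ) * (ξ : ℂ)) + Complex.I * (y : ℂ) * (ξ : ℂ) := by
          push_cast; ring
        rw [this, Complex.exp_add]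
        ring
    simp_rw [e]
    rw [intervalIntegral.integral_finsetSum fun y _ =>
      Continuous.intervalIntegrable (by fun_prop) _ _]
    simp only [convPow]
    rw [tsum_eq_sum (s := hφ.toFinset), Finset.mul_sum]
    · refine Finset.sum_congr rfl fun y _ => ?_
      rw [ih, intervalIntegral.integral_const_mul]
      ring
    · intro y hy
      rw [Finite.mem_toFinset, Function.notMem_support] at hy
      rw [hy, mul_zero]

theorem conj_fourierT (hφ : (Function.support φ).Finite) (ξ : ℝ) :
    (starRingEnd ℂ) (fourierT φ ξ) = ∑ x ∈ hφ.toFinset,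
      (starRingEnd ℂ) (φ x) * Complex.exp (-(Complex.I * (x : ℂ) * (ξ : ℂ))) := by
  rw [fourierT_eq_sum hφ, map_sum]
  refine Finset.sum_congr rfl fun x _ => ?_
  rw [map_mul, ← Complex.exp_conj]
  simp

/-- A trigonometric polynomial of constant modulus one is a monomial. -/
theorem exists_norm_fourierT_ne_one (hφ : AdmissibleSupport φ) : ∃ ξ, ‖fourierT φ ξ‖ ≠ 1 := by
  by_contra! hone
  obtain ⟨hfin, hnt⟩ := hφ
  set S := hfin.toFinset with hS
  have hSne : S.Nonempty := by
    rw [hS, Finite.toFinset_nonempty]; exact hnt.nonempty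
  set p := S.max' hSne with hp
  set r := S.min' hSne with hr
  have hpS : p ∈ S := S.max'_mem hSne
  have hrS : r ∈ S := S.min'_mem hSne
  have hlt : r < p := by
    refine Finset.min'_lt_max'_of_card S ?_
    rw [Finset.one_lt_card]
    obtain ⟨x, hx, y, hy, hxy⟩ := hnt
    exact ⟨x, hfin.mem_toFinset.mpr hx, y, hfin.mem_toFinset.mpr hy, hxy⟩
  have hφ0 : ∀ x ∈ S, φ x ≠ 0 := fun x hx => hfin.mem_toFinset.mp hx
  -- The proof compares one extreme Fourier coefficient of `|φ̂|²`. It vanishes if `|φ̂| = 1`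
  -- identically, while in the double sum only `x = p`, `y = r` survives and gives `2π φ(p) conj
  -- φ(r) ≠ 0`.
  have hzero : ∫ ξ in (-Real.pi)..Real.pi, Complex.exp (Complex.I * ((r - p : ℤ) : ℂ) * (ξ : ℂ)) *
      (fourierT φ ξ * (starRingEnd ℂ) (fourierT φ ξ)) = 0 := by
    have : ∀ ξ : ℝ, Complex.exp (Complex.I * ((r - p : ℤ) : ℂ) * (ξ : ℂ)) *
        (fourierT φ ξ * (starRingEnd ℂ) (fourierT φ ξ)) =
        Complex.exp (Complex.I * ((r - p : ℤ) : ℂ) * (ξ : ℂ)) := fun ξ => by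
      rw [Complex.mul_conj, Complex.normSq_eq_norm_sq, hone]
      simp
    simp_rw [this]
    rw [integral_exp_int, if_neg (by lia)]
  have hexp : ∀ ξ : ℝ, Complex.exp (Complex.I * ((r - p : ℤ) : ℂ) * (ξ : ℂ)) *
      (fourierT φ ξ * (starRingEnd ℂ) (fourierT φ ξ)) = ∑ x ∈ S, ∑ y ∈ S,
        φ x * (starRingEnd ℂ) (φ y) *
          Complex.exp (Complex.I * ((r - p + x - y : ℤ) : ℂ) * (ξ : ℂ)) := fun ξ => by
    rw [conj_fourierT hfin, fourierT_eq_sum hfin, Finset.sum_mul_sum, Finset.mul_sum]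
    refine Finset.sum_congr rfl fun x _ => ?_
    rw [Finset.mul_sum]
    refine Finset.sum_congr rfl fun y _ => ?_
    have : Complex.I * ((r - p + x - y : ℤ) : ℂ) * (ξ : ℂ) =
        Complex.I * ((r - p : ℤ) : ℂ) * (ξ : ℂ) + Complex.I * (x : ℂ) * (ξ : ℂ) +
          -(Complex.I * (y : ℂ) * (ξ : ℂ)) := by
      push_cast; ring
    rw [this, Complex.exp_add, Complex.exp_add]
    ring
  simp_rw [hexp] at hzero
  rw [intervalIntegral.integral_finsetSum fun x _ =>
    Continuous.intervalIntegrable (by fun_prop) _ _] at hzero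
  have hinner : ∀ x : ℤ, ∫ ξ in (-Real.pi)..Real.pi, ∑ y ∈ S, φ x * (starRingEnd ℂ) (φ y) *
      Complex.exp (Complex.I * ((r - p + x - y : ℤ) : ℂ) * (ξ : ℂ)) =
      ∑ y ∈ S, φ x * (starRingEnd ℂ) (φ y) *
        if r - p + x - y = 0 then 2 * (Real.pi : ℂ) else 0 := fun x => by
    rw [intervalIntegral.integral_finsetSum fun y _ =>
      Continuous.intervalIntegrable (by fun_prop) _ _]
    refine Finset.sum_congr rfl fun y _ => ?_
    rw [intervalIntegral.integral_const_mul, integral_exp_int]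
  simp_rw [hinner] at hzero
  rw [Finset.sum_eq_single_of_mem p hpS, Finset.sum_eq_single_of_mem r hrS,
    if_pos (by ring)] at hzero
  · have h1 := hφ0 p hpS
    have h2 := hφ0 r hrS
    simp [h1, h2, Real.pi_ne_zero] at hzero
  · intro y hy hyr
    rw [if_neg (by lia), mul_zero]
  · intro x hx hxp
    refine Finset.sum_eq_zero fun y hy => ?_
    have h1 : x ≤ p := S.le_max' x hx
    have h2 : r ≤ y := S.min'_le y hy
    rw [if_neg (by lia), mul_zero]

/-- An infinite `Ω` would accumulate in `[-π, π]`. The function `φ̂ · conj φ̂ - 1` is real analytic,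
so it would vanish identically, against `exists_norm_fourierT_ne_one`. -/
theorem finite_unitPoints (hφ : AdmissibleSupport φ) : (unitPoints (fourierT φ)).Finite := by
  by_contra hinf
  have hsub : unitPoints (fourierT φ) ⊆ Icc (-Real.pi) Real.pi := fun ξ hξ =>
    Ioc_subset_Icc_self hξ.1
  obtain ⟨z, -, hz⟩ := Set.Infinite.exists_accPt_of_subset_isCompact hinf isCompact_Icc hsub
  have han : ∀ ξ : ℝ, AnalyticAt ℝ
      (fun ξ => fourierT φ ξ * (starRingEnd ℂ) (fourierT φ ξ) - 1) ξ := fun ξ => by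
    have h := analyticAt_fourierT hφ.1 ξ
    have hconj : AnalyticAt ℝ (fun ξ => (starRingEnd ℂ) (fourierT φ ξ)) ξ :=
      (Complex.conjCLE.toContinuousLinearMap.analyticAt _).comp h
    exact (h.mul hconj).sub analyticAt_const
  have hfreq : ∃ᶠ ξ in 𝓝[≠] z, fourierT φ ξ * (starRingEnd ℂ) (fourierT φ ξ) - 1 = 0 := by
    refine (accPt_iff_frequently_nhdsNE.mp hz).mono fun ξ hξ => ?_
    rw [Complex.mul_conj, Complex.normSq_eq_norm_sq, hξ.2]
    simp
  have hzero := AnalyticOnNhd.eqOn_zero_of_preconnected_of_frequently_eq_zero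
    (U := univ) (fun ξ _ => han ξ) isPreconnected_univ (mem_univ z) hfreq
  obtain ⟨ξ, hξ⟩ := exists_norm_fourierT_ne_one hφ
  have h := hzero (mem_univ ξ)
  simp only [Pi.zero_apply, Complex.mul_conj, Complex.normSq_eq_norm_sq, sub_eq_zero] at h
  have h' : ‖fourierT φ ξ‖ ^ 2 = 1 := by exact_mod_cast h
  exact hξ ((pow_eq_one_iff_of_nonneg (norm_nonneg _) two_ne_zero).mp h')

theorem nonempty_unitPoints (hφ : AdmissibleSupport φ)
    (hsup : IsLUB (Set.range fun ξ : ℝ => ‖fourierT φ ξ‖) 1) :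
    (unitPoints (fourierT φ)).Nonempty := by
  have hper : Function.Periodic (fun ξ => ‖fourierT φ ξ‖) (2 * Real.pi) := fun ξ => by
    simp only [periodic_fourierT φ ξ]
  have hcomp := hper.compact_of_continuous Real.two_pi_pos.ne' (continuous_fourierT hφ.1).norm
  obtain ⟨ξ, hξ⟩ := hsup.mem_of_isClosed (range_nonempty _) hcomp.isClosed
  obtain ⟨y, hy, he⟩ := hper.exists_mem_Ioc Real.two_pi_pos ξ (-Real.pi)
  refine ⟨y, ⟨hy.1, hy.2.trans_eq (by ring)⟩, ?_⟩
  rw [← hξ]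
  exact he.symm

end Fourier

/-! ### From the local form of a phase to one-sided estimates. -/

/-- Near `0`, `G ξ = i a ξ + ξ ^ m g ξ` with `g` analytic and `g 0 = -b ≠ 0`, and `Re G ≤ 0`. -/
structure HasLocalForm (G : ℝ → ℂ) (a : ℝ) (b : ℂ) (m : ℕ) : Prop where
  two_le : 2 ≤ m
  b_ne : b ≠ 0
  form : ∃ g : ℝ → ℂ, AnalyticAt ℝ g 0 ∧ g 0 = -b ∧
    ∀ᶠ ξ in 𝓝 0, G ξ = Complex.I * a * ξ + (ξ : ℂ) ^ m * g ξ
  re_le : ∀ᶠ ξ in 𝓝 0, (G ξ).re ≤ 0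

namespace HasLocalForm

variable {G : ℝ → ℂ} {a : ℝ} {b : ℂ} {m : ℕ}

theorem comp_neg (h : HasLocalForm G a b m) :
    HasLocalForm (fun ξ => G (-ξ)) (-a) ((-1) ^ m * b) m := by
  obtain ⟨g, hg, hg0, hG⟩ := h.form
  have hneg : Tendsto (fun ξ : ℝ => -ξ) (𝓝 0) (𝓝 0) := by
    simpa using (continuous_neg (G := ℝ)).tendsto 0
  refine ⟨h.two_le, mul_ne_zero (pow_ne_zero _ (by norm_num)) h.b_ne,
    ⟨fun ξ => (-1) ^ m * g (-ξ), ?_, by simp [hg0], ?_⟩, hneg.eventually h.re_le⟩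
  · have hg' : AnalyticAt ℝ g (-(0 : ℝ)) := by rwa [neg_zero]
    exact analyticAt_const.mul (AnalyticAt.fun_comp hg' analyticAt_id.neg)
  · filter_upwards [hneg.eventually hG] with ξ hξ
    rw [hξ]
    push_cast
    rw [neg_pow (ξ : ℂ)]
    ring

theorem isLittleO (h : HasLocalForm G a b m) :
    (fun ξ : ℝ => G ξ - (Complex.I * a * ξ - b * (ξ : ℂ) ^ m)) =o[𝓝 0] fun ξ : ℝ => ξ ^ m := by
  obtain ⟨g, hg, hg0, hG⟩ := h.form
  have h1 : (fun ξ : ℝ => g ξ + b) =o[𝓝 0] fun _ : ℝ => (1 : ℝ) := by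
    rw [Asymptotics.isLittleO_one_iff]
    have := hg.continuousAt.tendsto.add_const b
    rwa [hg0, neg_add_cancel] at this
  have h2 : (fun ξ : ℝ => (ξ : ℂ) ^ m) =O[𝓝 0] fun ξ : ℝ => ξ ^ m :=
    Asymptotics.isBigO_of_le _ fun ξ => by rw [norm_pow, norm_pow, Complex.norm_real]
  refine ((h2.mul_isLittleO h1).congr' ?_ (by simp))
  filter_upwards [hG] with ξ hξ
  rw [hξ]
  ring

/-- Divide `Re G ≤ 0` by `ξ ^ m > 0` and let `ξ` decrease to `0`. For the reflected phase this gives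
`0 ≤ Re ((-1) ^ m * b)`, hence `Re b = 0` for odd `m`. -/
theorem re_nonneg (h : HasLocalForm G a b m) : 0 ≤ b.re := by
  obtain ⟨g, hg, hg0, hG⟩ := h.form
  have hlim : Tendsto (fun ξ => (g ξ).re) (𝓝[>] 0) (𝓝 (g 0).re) :=
    (Complex.continuous_re.continuousAt.tendsto.comp hg.continuousAt.tendsto).mono_left
      nhdsWithin_le_nhds
  have hle : (g 0).re ≤ 0 := by
    refine le_of_tendsto hlim ?_
    filter_upwards [nhdsWithin_le_nhds hG, nhdsWithin_le_nhds h.re_le, self_mem_nhdsWithin]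
      with ξ h1 h2 h3
    have hpos : 0 < ξ ^ m := pow_pos h3 m
    rw [h1, Complex.add_re, ← Complex.ofReal_pow, Complex.re_ofReal_mul] at h2
    simp at h2
    exact nonpos_of_mul_nonpos_right h2 hpos
  rw [hg0, Complex.neg_re] at hle
  linarith

/-- Differentiation gives `G' = i a + ξ^(m-1) k₁` and `G'' = ξ^(m-2) k₂` with `k₁ 0 = -m b` and `k₂
0 = -m(m-1) b`. Multiplied by `sectorDir b` both values become positive reals, at least `2 ‖b‖`, so
the bounds with `c = ‖b‖` and the sector condition are strict at `0` and persist nearby. -/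
theorem exists_isOneSidedPhase (h : HasLocalForm G a b m) :
    ∃ G' G'' : ℝ → ℂ, ∃ ω : ℂ, ∃ c δ : ℝ, IsOneSidedPhase G G' G'' a b ω m c δ := by
  obtain ⟨g, hg, hg0, hG⟩ := h.form
  obtain ⟨k, rfl⟩ := Nat.exists_eq_add_of_le' h.two_le
  have hnb : 0 < ‖b‖ := norm_pos_iff.mpr h.b_ne
  set k₁ : ℝ → ℂ := fun ξ => (k + 2) * g ξ + ξ * deriv g ξ with hk₁
  set k₂ : ℝ → ℂ := fun ξ => (k + 2) * (k + 1) * g ξ + 2 * (k + 2) * ξ * deriv g ξ +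
    (ξ : ℂ) ^ 2 * deriv (deriv g) ξ with hk₂
  have hofReal : ∀ ξ : ℝ, ContinuousAt (fun ξ : ℝ => (ξ : ℂ)) ξ :=
    fun ξ => Complex.continuous_ofReal.continuousAt
  have c₁ : ∀ ξ, AnalyticAt ℝ g ξ → ContinuousAt k₁ ξ := fun ξ hξ =>
    (continuousAt_const.mul hξ.continuousAt).add ((hofReal ξ).mul hξ.deriv.continuousAt)
  have c₂ : ∀ ξ, AnalyticAt ℝ g ξ → ContinuousAt k₂ ξ := fun ξ hξ =>
    ((continuousAt_const.mul hξ.continuousAt).add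
      ((continuousAt_const.mul (hofReal ξ)).mul hξ.deriv.continuousAt)).add
      (((hofReal ξ).pow 2).mul hξ.deriv.deriv.continuousAt)
  have v₁ : sectorDir b * k₁ 0 = (((k + 2) * ‖b‖ : ℝ) : ℂ) := by
    have := sectorDir_mul_neg h.b_ne
    simp only [hk₁, hg0, Complex.ofReal_zero, zero_mul, add_zero]
    push_cast
    rw [← this]
    ring
  have v₂ : sectorDir b * k₂ 0 = (((k + 2) * (k + 1) * ‖b‖ : ℝ) : ℂ) := by
    have := sectorDir_mul_neg h.b_ne
    simp only [hk₂, hg0, Complex.ofReal_zero, mul_zero, zero_mul, add_zero,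
      zero_pow two_ne_zero]
    push_cast
    rw [← this]
    ring
  have n₂ : ‖k₂ 0‖ = (k + 2) * (k + 1) * ‖b‖ := by
    simp only [hk₂, hg0, Complex.ofReal_zero, mul_zero, zero_mul, add_zero,
      zero_pow two_ne_zero]
    rw [norm_mul, norm_neg, norm_mul]
    norm_cast
  have hkb : 0 ≤ (k : ℝ) * ‖b‖ := by positivity
  have hkb2 : 0 ≤ (k : ℝ) * (k * ‖b‖) := by positivity
  have hre : ∀ f : ℝ → ℂ, ContinuousAt f 0 →
      Tendsto (fun ξ => (sectorDir b * f ξ).re) (𝓝 0) (𝓝 (sectorDir b * f 0).re) := fun f hf =>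
    Complex.continuous_re.continuousAt.tendsto.comp (hf.tendsto.const_mul _)
  have e₁ : ∀ᶠ ξ in 𝓝 (0 : ℝ), ‖b‖ < (sectorDir b * k₁ ξ).re := by
    refine (hre k₁ (c₁ 0 hg)).eventually (lt_mem_nhds ?_)
    rw [v₁, Complex.ofReal_re]
    linarith
  have e₂ : ∀ᶠ ξ in 𝓝 (0 : ℝ), ‖b‖ < (sectorDir b * k₂ ξ).re := by
    refine (hre k₂ (c₂ 0 hg)).eventually (lt_mem_nhds ?_)
    rw [v₂, Complex.ofReal_re]
    linarith
  have e₃ : ∀ᶠ ξ in 𝓝 (0 : ℝ), ‖k₂ ξ‖ < 2 * (sectorDir b * k₂ ξ).re := by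
    refine (c₂ 0 hg).tendsto.norm.eventually_lt ((hre k₂ (c₂ 0 hg)).const_mul 2) ?_
    rw [v₂, Complex.ofReal_re, n₂]
    linarith
  obtain ⟨r, hr, hball⟩ := Metric.eventually_nhds_iff.mp
    (((((hG.eventually_nhds.and hg.eventually_analyticAt).and h.re_le).and e₁).and e₂).and e₃)
  have hmem : ∀ ξ ∈ Icc 0 (r / 2), dist ξ 0 < r := fun ξ hξ => by
    rw [Real.dist_0_eq_abs, abs_of_nonneg hξ.1]; linarith [hξ.2]
  have hpow : ∀ (j : ℕ) (u : ℝ),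
      HasDerivAt (fun u : ℝ => (u : ℂ) ^ (j + 1)) ((j + 1) * (u : ℂ) ^ j) u := fun j u => by
    simpa using (hasDerivAt_pow (j + 1) (u : ℂ)).comp_ofReal
  have hrpow : ∀ (j : ℕ) (ξ : ℝ) (z : ℂ), (sectorDir b * ((ξ : ℂ) ^ j * z)).re =
      ξ ^ j * (sectorDir b * z).re := fun j ξ z => by
    rw [mul_left_comm, ← Complex.ofReal_pow, Complex.re_ofReal_mul]
  refine ⟨fun ξ => Complex.I * a + (ξ : ℂ) ^ (k + 1) * k₁ ξ, fun ξ => (ξ : ℂ) ^ k * k₂ ξ,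
    sectorDir b, ‖b‖, r / 2, h.two_le, hnb, by positivity, norm_sectorDir_le b, h.b_ne, h.re_nonneg,
    fun ξ hξ => ?_, fun ξ hξ => ?_, fun ξ hξ => ?_, fun ξ hξ => (hball (hmem ξ hξ)).1.1.1.2,
    by simp, fun ξ hξ => ?_, fun ξ hξ => ?_, fun ξ hξ => ?_, fun ε hε => ?_⟩
  · obtain ⟨⟨⟨⟨⟨hGξ, hgξ⟩, -⟩, -⟩, -⟩, -⟩ := hball (hmem ξ hξ)
    have d1 := (Complex.ofRealCLM.hasDerivAt (x := ξ)).const_mul (Complex.I * a)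
    have d2 := (hpow (k + 1) ξ).fun_mul hgξ.differentiableAt.hasDerivAt
    refine ((d1.fun_add d2).congr_of_eventuallyEq hGξ).congr_deriv ?_
    simp only [hk₁, Complex.ofRealCLM_apply, Complex.ofReal_one]
    push_cast
    ring
  · obtain ⟨⟨⟨⟨⟨-, hgξ⟩, -⟩, -⟩, -⟩, -⟩ := hball (hmem ξ hξ)
    have d0 := hgξ.differentiableAt.hasDerivAt.const_mul ((k : ℂ) + 2)
    have d1 := (Complex.ofRealCLM.hasDerivAt (x := ξ)).fun_mul
      hgξ.deriv.differentiableAt.hasDerivAt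
    have d2 := ((hpow k ξ).fun_mul (d0.fun_add d1)).const_add (Complex.I * a)
    refine d2.congr_deriv ?_
    simp only [hk₂, Complex.ofRealCLM_apply, Complex.ofReal_one]
    ring
  · obtain ⟨⟨⟨⟨⟨-, hgξ⟩, -⟩, -⟩, -⟩, -⟩ := hball (hmem ξ hξ)
    exact (((hofReal ξ).pow k).mul (c₂ ξ hgξ)).continuousWithinAt
  · have := (hball (hmem ξ hξ)).1.1.2
    simp only [add_sub_cancel_left]
    rw [hrpow, mul_comm]
    exact mul_le_mul_of_nonneg_left this.le (pow_nonneg hξ.1 _)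
  · have := (hball (hmem ξ hξ)).1.2
    rw [hrpow, mul_comm]
    exact mul_le_mul_of_nonneg_left this.le (pow_nonneg hξ.1 _)
  · have := (hball (hmem ξ hξ)).2
    rw [hrpow, norm_mul, norm_pow, Complex.norm_real, Real.norm_of_nonneg hξ.1, mul_left_comm]
    exact mul_le_mul_of_nonneg_left this.le (pow_nonneg hξ.1 _)
  · obtain ⟨s, hs, hb⟩ := Metric.eventually_nhds_iff.mp (h.isLittleO.bound hε)
    refine ⟨s / 2, by positivity, fun ξ hξ => ?_⟩
    have := hb (y := ξ) (by rw [Real.dist_0_eq_abs, abs_of_nonneg hξ.1]; linarith [hξ.2])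
    rwa [norm_pow, Real.norm_of_nonneg hξ.1] at this

end HasLocalForm

/-! ### Taylor expansion of the local logarithm. -/

section LocalLog

variable {ν : ℝ → ℂ} {ξ₀ : ℝ}

theorem ne_zero_of_norm_eq_one (h1 : ‖ν ξ₀‖ = 1) : ν ξ₀ ≠ 0 := by
  rw [← norm_pos_iff, h1]
  exact one_pos

theorem analyticAt_localLog (hν : AnalyticAt ℝ ν ξ₀) (h1 : ‖ν ξ₀‖ = 1) :
    AnalyticAt ℝ (localLog ν ξ₀) 0 := by
  have h0 := ne_zero_of_norm_eq_one h1
  have hν' : AnalyticAt ℝ ν (0 + ξ₀) := by rwa [zero_add]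
  have hq : AnalyticAt ℝ (fun ξ => ν (ξ + ξ₀) / ν ξ₀) 0 :=
    (AnalyticAt.fun_comp (f := fun ξ => ξ + ξ₀) hν' (analyticAt_id.add analyticAt_const)).div
      analyticAt_const h0
  have hlog : AnalyticAt ℝ Complex.log (ν (0 + ξ₀) / ν ξ₀) := by
    rw [zero_add, div_self h0]
    exact (analyticAt_clog Complex.one_mem_slitPlane).restrictScalars
  exact AnalyticAt.fun_comp (f := fun ξ => ν (ξ + ξ₀) / ν ξ₀) hlog hq

theorem localLog_zero (h1 : ‖ν ξ₀‖ = 1) : localLog ν ξ₀ 0 = 0 := by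
  rw [localLog, zero_add, div_self (ne_zero_of_norm_eq_one h1), Complex.log_one]

theorem localLog_re_le (h1 : ‖ν ξ₀‖ = 1) (hle : ∀ ξ, ‖ν ξ‖ ≤ 1) (ξ : ℝ) :
    (localLog ν ξ₀ ξ).re ≤ 0 := by
  rw [localLog, Complex.log_re, norm_div, h1, div_one]
  exact Real.log_nonpos (norm_nonneg _) (hle _)

theorem eventually_exp_localLog (hν : ContinuousAt ν ξ₀) (h1 : ‖ν ξ₀‖ = 1) :
    ∀ᶠ ξ in 𝓝 0, ν (ξ + ξ₀) = ν ξ₀ * Complex.exp (localLog ν ξ₀ ξ) := by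
  have h0 := ne_zero_of_norm_eq_one h1
  have hlim : Tendsto (fun ξ : ℝ => ξ + ξ₀) (𝓝 0) (𝓝 ξ₀) := by
    simpa using (continuous_add_const ξ₀).tendsto (0 : ℝ)
  filter_upwards [hlim.eventually (hν.eventually_ne h0)] with ξ hξ
  rw [localLog, Complex.exp_log (div_ne_zero hξ h0), mul_div_cancel₀ _ h0]

/-- `Re Γ ≤ 0` has a maximum at `0`, so `Γ'(0)` is purely imaginary. -/
theorem deriv_localLog_zero (hν : AnalyticAt ℝ ν ξ₀) (h1 : ‖ν ξ₀‖ = 1) (hle : ∀ ξ, ‖ν ξ‖ ≤ 1) :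
    deriv (localLog ν ξ₀) 0 = Complex.I * drift ν ξ₀ := by
  have hd := (analyticAt_localLog hν h1).differentiableAt.hasDerivAt
  have hre : HasDerivAt (fun ξ => (localLog ν ξ₀ ξ).re) (deriv (localLog ν ξ₀) 0).re 0 := by
    simpa using hasDerivAt_re_mul 1 hd
  have hmax : IsLocalMax (fun ξ => (localLog ν ξ₀ ξ).re) 0 :=
    Eventually.of_forall fun ξ => by
      simp only [localLog_zero h1, Complex.zero_re]
      exact localLog_re_le h1 hle ξ
  apply Complex.ext
  · rw [hmax.hasDerivAt_eq_zero hre]; simp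
  · simp [drift]

/-- Taylor expansion of the local logarithm when its derivatives of order `2, …, n - 1` vanish. -/
theorem exists_localLog_eq (hν : AnalyticAt ℝ ν ξ₀) (h1 : ‖ν ξ₀‖ = 1) (hle : ∀ ξ, ‖ν ξ‖ ≤ 1)
    {n : ℕ} (hn : 2 ≤ n)
    (hz : ∀ k, 2 ≤ k → k < n → iteratedDeriv k (localLog ν ξ₀) 0 = 0) :
    ∃ F : ℝ → ℂ, AnalyticAt ℝ F 0 ∧ ∀ᶠ ξ : ℝ in 𝓝 0, localLog ν ξ₀ ξ =
      Complex.I * drift ν ξ₀ * ξ + (ξ : ℂ) ^ n * F ξ := by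
  obtain ⟨F, hF, hΓ⟩ := (analyticAt_localLog hν h1).exists_eventuallyEq_sum_add_pow_mul n
  refine ⟨F, hF, hΓ.mono fun ξ hξ => ?_⟩
  obtain ⟨k, rfl⟩ := Nat.exists_eq_add_of_le' hn
  rw [hξ, Finset.sum_range_succ', Finset.sum_range_succ', Finset.sum_eq_zero]
  · simp [iteratedDeriv_one, localLog_zero h1, deriv_localLog_zero hν h1 hle]
    ring
  · intro i hi
    rw [hz (i + 1 + 1) (by lia) (by have := Finset.mem_range.mp hi; lia), smul_zero]

/-- Otherwise analyticity makes `Γ` linear with imaginary slope near `0`, and `|ν|` would be `1`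
near `ξ₀`. -/
theorem exists_iteratedDeriv_ne_zero (hν : AnalyticAt ℝ ν ξ₀) (h1 : ‖ν ξ₀‖ = 1)
    (hle : ∀ ξ, ‖ν ξ‖ ≤ 1) (hiso : ¬ ∀ᶠ ξ in 𝓝 ξ₀, ‖ν ξ‖ = 1) :
    ∃ k, 2 ≤ k ∧ iteratedDeriv k (localLog ν ξ₀) 0 ≠ 0 := by
  by_contra! hz
  set f : ℝ → ℂ := fun ξ => localLog ν ξ₀ ξ - Complex.I * drift ν ξ₀ * ξ with hf
  have hfa : AnalyticAt ℝ f 0 :=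
    (analyticAt_localLog hν h1).sub (analyticAt_const.mul (Complex.ofRealCLM.analyticAt 0))
  have htop : analyticOrderAt f 0 = ⊤ := by
    refine ENat.eq_top_iff_forall_ge.mpr fun n => ?_
    refine le_trans (Nat.cast_le.mpr (Nat.le_add_right n 2))
      ((natCast_le_analyticOrderAt hfa (n := n + 2)).mpr ?_)
    obtain ⟨F, hF, hΓ⟩ := exists_localLog_eq hν h1 hle (n := n + 2) (by lia)
      fun k hk _ => hz k hk
    refine ⟨F, hF, hΓ.mono fun ξ hξ => ?_⟩
    simp [hf, hξ]
  refine hiso ?_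
  have hlim : Tendsto (fun ξ : ℝ => ξ - ξ₀) (𝓝 ξ₀) (𝓝 0) := by
    simpa using (continuous_sub_right ξ₀).tendsto ξ₀
  filter_upwards [hlim.eventually (analyticOrderAt_eq_top.mp htop),
    hlim.eventually (eventually_exp_localLog hν.continuousAt h1)] with ξ h2 h3
  rw [sub_add_cancel] at h3
  rw [h3, norm_mul, h1, one_mul, sub_eq_zero.mp h2, Complex.norm_exp]
  simp

theorem hasLocalForm_localLog (hν : AnalyticAt ℝ ν ξ₀) (h1 : ‖ν ξ₀‖ = 1)
    (hle : ∀ ξ, ‖ν ξ‖ ≤ 1) (hiso : ¬ ∀ᶠ ξ in 𝓝 ξ₀, ‖ν ξ‖ = 1) :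
    HasLocalForm (localLog ν ξ₀) (drift ν ξ₀) (coeff ν ξ₀) (order ν ξ₀) := by
  obtain ⟨hm, hne⟩ := Nat.sInf_mem (exists_iteratedDeriv_ne_zero hν h1 hle hiso)
  change 2 ≤ order ν ξ₀ at hm
  change iteratedDeriv (order ν ξ₀) (localLog ν ξ₀) 0 ≠ 0 at hne
  have hz : ∀ k, 2 ≤ k → k < order ν ξ₀ → iteratedDeriv k (localLog ν ξ₀) 0 = 0 :=
    fun k hk hlt => by
      by_contra hcon
      have hmem : k ∈ {k : ℕ | 2 ≤ k ∧ iteratedDeriv k (localLog ν ξ₀) 0 ≠ 0} := ⟨hk, hcon⟩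
      exact absurd (Nat.sInf_le hmem) (not_le.mpr hlt)
  have hfac : ((order ν ξ₀).factorial : ℂ) ≠ 0 := Nat.cast_ne_zero.mpr (Nat.factorial_ne_zero _)
  refine ⟨hm, neg_ne_zero.mpr (div_ne_zero hne hfac), ?_,
    Eventually.of_forall fun ξ => localLog_re_le h1 hle ξ⟩
  -- Expanding one order beyond `m` isolates the coefficient `-β`, so that the cofactor of `ξ ^ m`
  -- is `-β + ξ F`.
  obtain ⟨F, hF, hΓ⟩ := (analyticAt_localLog hν h1).exists_eventuallyEq_sum_add_pow_mul
    (order ν ξ₀ + 1)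
  refine ⟨fun ξ => -coeff ν ξ₀ + ξ * F ξ,
    analyticAt_const.add ((Complex.ofRealCLM.analyticAt 0).mul hF), by simp,
    hΓ.mono fun ξ hξ => ?_⟩
  obtain ⟨k, hk⟩ := Nat.exists_eq_add_of_le' hm
  rw [hξ, Finset.sum_range_succ, coeff, neg_neg]
  generalize hD : iteratedDeriv (order ν ξ₀) (localLog ν ξ₀) 0 = D
  rw [hk] at hz hfac ⊢
  rw [Finset.sum_range_succ', Finset.sum_range_succ', Finset.sum_eq_zero]
  · simp [iteratedDeriv_one, localLog_zero h1, deriv_localLog_zero hν h1 hle]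
    ring
  · intro i hi
    rw [hz (i + 1 + 1) (by lia) (by have := Finset.mem_range.mp hi; lia), smul_zero]

end LocalLog

/-! ### Comparison of scales, and which points contribute. -/

/-- The natural scale `n ^ (-1 / m)`. -/
def scale (m n : ℕ) : ℝ := (n : ℝ) ^ (-(1 / (m : ℝ)))

theorem scale_pos (m : ℕ) {n : ℕ} (hn : 0 < n) : 0 < scale m n :=
  Real.rpow_pos_of_pos (Nat.cast_pos.mpr hn) _

theorem mul_scale_pow {m n : ℕ} (hm : m ≠ 0) (hn : 0 < n) : n * scale m n ^ m = 1 := by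
  have hn' : (0 : ℝ) < n := Nat.cast_pos.mpr hn
  have hm' : (m : ℝ) ≠ 0 := Nat.cast_ne_zero.mpr hm
  rw [scale, ← Real.rpow_mul_natCast hn'.le, neg_mul, one_div_mul_cancel hm', Real.rpow_neg_one,
    mul_inv_cancel₀ hn'.ne']

theorem div_scale (m n : ℕ) (x : ℝ) : x / scale m n = x * (n : ℝ) ^ (1 / (m : ℝ)) := by
  rw [scale, Real.rpow_neg n.cast_nonneg, div_inv_eq_mul]

/-- This lets `O(1 / n)` bounds be compared with the main scale through `eventually_scale_le`. -/
theorem scale_one (n : ℕ) : scale 1 n = 1 / n := by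
  rw [scale, Nat.cast_one, div_one, Real.rpow_neg_one, one_div]

theorem tendsto_scale {m : ℕ} (hm : m ≠ 0) : Tendsto (scale m) atTop (𝓝 0) :=
  (tendsto_rpow_neg_atTop (by positivity : 0 < 1 / (m : ℝ))).comp tendsto_natCast_atTop_atTop

theorem eventually_scale_mem {m : ℕ} (hm : m ≠ 0) {η₀ : ℝ} (hη₀ : 0 < η₀) :
    ∀ᶠ n in atTop, scale m n ∈ Ioc 0 η₀ := by
  filter_upwards [(tendsto_scale hm).eventually_le_const hη₀, eventually_gt_atTop 0] with n h1 h2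
  exact ⟨scale_pos m h2, h1⟩

theorem eventually_scale_le {m₀ m : ℕ} (hm₀ : m₀ ≠ 0) (hlt : m₀ < m) {ε : ℝ} (hε : 0 < ε) :
    ∀ᶠ n in atTop, scale m₀ n ≤ ε * scale m n := by
  have h0 : (0 : ℝ) < m₀ := Nat.cast_pos.mpr (Nat.pos_of_ne_zero hm₀)
  have hpos : (0 : ℝ) < 1 / m₀ - 1 / m := sub_pos.mpr
    (one_div_lt_one_div_of_lt h0 (Nat.cast_lt.mpr hlt))
  have hlim := (tendsto_rpow_neg_atTop hpos).comp tendsto_natCast_atTop_atTop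
  filter_upwards [hlim.eventually_le_const hε, eventually_gt_atTop 0] with n h1 h2
  have hn : (0 : ℝ) < n := Nat.cast_pos.mpr h2
  have e : scale m₀ n = (n : ℝ) ^ (-(1 / (m₀ : ℝ) - 1 / m)) * scale m n := by
    rw [scale, scale, ← Real.rpow_add hn]
    congr 1
    ring
  rw [e]
  exact mul_le_mul_of_nonneg_right h1 (scale_pos m h2).le

open Classical in
/-- Only the points of maximal order `m` and of drift `a'` contribute at scale `n ^ (-1 / m)`. -/
theorem IsOneSidedPhase.eventually_norm_integral_sub_le {G G' G'' : ℝ → ℂ} {a : ℝ} {b ω : ℂ}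
    {m₀ : ℕ} {c δ₀ : ℝ} (h : IsOneSidedPhase G G' G'' a b ω m₀ c δ₀) {m : ℕ} (hm : m₀ ≤ m)
    (a' : ℝ) : ∀ᶠ δ in 𝓝[>] (0 : ℝ), ∀ X ε : ℝ, 0 < ε → ∀ᶠ n : ℕ in atTop, ∀ x l : ℝ, |x| ≤ X →
      |l - (n * a' + x / scale m n)| ≤ 1 →
      ‖(∫ ξ in (0 : ℝ)..δ, Complex.exp ((n : ℂ) * G ξ - Complex.I * l * ξ)) -
        scale m n * (if m₀ = m ∧ a = a' then halfAttractor m b x else 0)‖ ≤ ε * scale m n := by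
  have hm2 := h.two_le
  have hle : ∀ᶠ δ in 𝓝[>] (0 : ℝ), 0 < δ ∧ δ ≤ δ₀ := by
    filter_upwards [Ioc_mem_nhdsGT h.δ_pos] with δ hδ using hδ
  rcases hm.lt_or_eq with hlt | rfl
  · filter_upwards [hle] with δ hδ X ε hε
    have h' := h.mono hδ.1 hδ.2
    have hC : 0 < 1 + 14 / √c := by positivity
    filter_upwards [eventually_scale_le (by lia) hlt (div_pos hε hC), eventually_gt_atTop 0]
      with n h1 h2 x l _ _
    rw [if_neg (fun h => hlt.ne h.1), mul_zero, sub_zero]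
    refine (h'.norm_integral_le (scale_pos m₀ h2) (mul_scale_pow (by lia) h2) l).trans ?_
    calc (1 + 14 / √c) * scale m₀ n ≤ (1 + 14 / √c) * (ε / (1 + 14 / √c) * scale m n) :=
          mul_le_mul_of_nonneg_left h1 hC.le
      _ = ε * scale m n := by field_simp
  by_cases ha : a = a'
  · filter_upwards [hle] with δ hδ X ε hε
    obtain ⟨η₀, hη₀, hmain⟩ := (h.mono hδ.1 hδ.2).norm_integral_sub_le X hε
    filter_upwards [eventually_scale_mem (m := m₀) (by lia) hη₀, eventually_gt_atTop 0]
      with n h1 h2 x l hx hl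
    rw [if_pos ⟨rfl, ha⟩]
    exact hmain _ h1 n (mul_scale_pow (by lia) h2) x l hx (by rwa [ha])
  -- The drift gap is `2κ`. One `κ n` absorbs the displacement `x / scale` and the rounding, which
  -- are `o(n)`; the other remains as the mismatch.
  · set κ := |a - a'| / 2 with hκ
    have hκ0 : 0 < κ := half_pos (abs_pos.mpr (sub_ne_zero.mpr ha))
    have hcont : ∀ᶠ ξ in 𝓝 (0 : ℝ), ‖G' ξ - Complex.I * a‖ < κ / 2 := by
      have hG' := (h.deriv_two 0 (left_mem_Icc.mpr h.δ_pos.le)).continuousAt.tendsto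
      have := (hG'.sub_const (Complex.I * a)).norm
      rw [h.deriv_zero, sub_self, norm_zero] at this
      exact this.eventually (gt_mem_nhds (half_pos hκ0))
    obtain ⟨r, hr, hball⟩ := Metric.eventually_nhds_iff.mp hcont
    filter_upwards [hle, Ioo_mem_nhdsGT hr] with δ hδ hδr X ε hε
    have h' := h.mono hδ.1 hδ.2
    obtain ⟨M, hM⟩ := isCompact_Icc.exists_bound_of_continuousOn h'.cont
    have hM0 : 0 ≤ M := (norm_nonneg _).trans (hM 0 (left_mem_Icc.mpr hδ.1.le))
    have hδ0 := hδ.1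
    set C := 4 / κ + 4 * M * δ / κ ^ 2
    have hC : 0 < C := by positivity
    have hX : 0 < |X| + 1 := by positivity
    filter_upwards [eventually_scale_mem (m := m₀) (by lia)
        (lt_min one_pos (div_pos hκ0 hX)),
      eventually_scale_le one_ne_zero (by lia : 1 < m₀) (div_pos hε hC), eventually_gt_atTop 0]
      with n h1 h2 h3 x l hx hl
    have hn : (0 : ℝ) < n := Nat.cast_pos.mpr h3
    rw [if_neg (fun h => ha h.2), mul_zero, sub_zero]
    have hs0 := h1.1
    have hs1 : scale m₀ n ≤ 1 := h1.2.trans (min_le_left _ _)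
    have hs2 : scale m₀ n * (|X| + 1) ≤ κ := by
      rw [← le_div_iff₀ hX]; exact h1.2.trans (min_le_right _ _)
    -- As the scale `η` is at most `1` and `m₀ ≥ 2`, `n η² ≥ n η^m₀ = 1`.
    have hinv : 1 / scale m₀ n ≤ n * scale m₀ n := by
      rw [div_le_iff₀ hs0, mul_assoc, ← sq, ← mul_scale_pow (m := m₀) (by lia) h3]
      exact mul_le_mul_of_nonneg_left (pow_le_pow_of_le_one hs0.le hs1 hm2) hn.le
    have hlow : κ * n ≤ |n * a - l| := by
      have e : n * (a - a') = (n * a - l) + (l - (n * a' + x / scale m₀ n)) + x / scale m₀ n := by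
        ring
      have e1 : n * (2 * κ) = |n * (a - a')| := by
        rw [abs_mul, abs_of_pos hn, hκ]; ring
      have e2 : |x / scale m₀ n| ≤ |X| * (1 / scale m₀ n) := by
        rw [abs_div, abs_of_pos hs0, mul_one_div]
        exact div_le_div_of_nonneg_right (hx.trans (le_abs_self _)) hs0.le
      have e3 : 1 ≤ 1 / scale m₀ n := (one_le_div hs0).mpr hs1
      have e4 : (|X| + 1) * (1 / scale m₀ n) ≤ κ * n := by
        calc (|X| + 1) * (1 / scale m₀ n) ≤ (|X| + 1) * (n * scale m₀ n) :=
              mul_le_mul_of_nonneg_left hinv hX.le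
          _ = scale m₀ n * (|X| + 1) * n := by ring
          _ ≤ κ * n := mul_le_mul_of_nonneg_right hs2 hn.le
      have e5 := abs_add_three (n * a - l) (l - (n * a' + x / scale m₀ n)) (x / scale m₀ n)
      rw [← e, ← e1] at e5
      linarith
    refine (h'.norm_integral_le_of_drift h3 hκ0 hlow (fun ξ hξ => (hball ?_).le) hM).trans ?_
    · rw [Real.dist_0_eq_abs, abs_of_nonneg hξ.1]
      exact hξ.2.trans_lt hδr.2
    · calc C / n = C * scale 1 n := by rw [scale_one, mul_one_div]
        _ ≤ C * (ε / C * scale m₀ n) := mul_le_mul_of_nonneg_left h2 hC.le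
        _ = ε * scale m₀ n := by field_simp

/-! ### Local and exponentially small parts of the inversion integral. -/

section LocalIntegral

variable {ν : ℝ → ℂ} {ξ₀ : ℝ}

/-- The integrand of the inversion formula. -/
def inversionFun (ν : ℝ → ℂ) (n : ℕ) (k : ℤ) (ξ : ℝ) : ℂ :=
  Complex.exp (-(Complex.I * (k : ℂ) * (ξ : ℂ))) * ν ξ ^ n

theorem continuous_inversionFun (hν : Continuous ν) (n : ℕ) (k : ℤ) :
    Continuous (inversionFun ν n k) := by
  unfold inversionFun; fun_prop

theorem norm_inversionFun (n : ℕ) (k : ℤ) (ξ : ℝ) : ‖inversionFun ν n k ξ‖ = ‖ν ξ‖ ^ n := by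
  rw [inversionFun, norm_mul, norm_pow, Complex.norm_exp]
  simp

theorem integral_inversionFun_eq (hν : Continuous ν) (h1 : ‖ν ξ₀‖ = 1) :
    ∀ᶠ δ in 𝓝[>] (0 : ℝ), ∀ (n : ℕ) (k : ℤ),
      ∫ ξ in ξ₀ - δ..ξ₀ + δ, inversionFun ν n k ξ = inversionFun ν n k ξ₀ *
        ((∫ ξ in (0 : ℝ)..δ,
            Complex.exp ((n : ℂ) * localLog ν ξ₀ ξ - Complex.I * ((k : ℝ) : ℂ) * ξ)) +
          ∫ ξ in (0 : ℝ)..δ,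
            Complex.exp ((n : ℂ) * localLog ν ξ₀ (-ξ) - Complex.I * ((-k : ℝ) : ℂ) * ξ)) := by
  obtain ⟨r, hr, hball⟩ :=
    Metric.eventually_nhds_iff.mp (eventually_exp_localLog hν.continuousAt h1)
  filter_upwards [Ioo_mem_nhdsGT hr] with δ hδ n k
  have hc := continuous_inversionFun hν n k
  have hval : ∀ ξ : ℝ, |ξ| ≤ δ → inversionFun ν n k (ξ + ξ₀) = inversionFun ν n k ξ₀ *
      Complex.exp ((n : ℂ) * localLog ν ξ₀ ξ - Complex.I * ((k : ℝ) : ℂ) * ξ) := fun ξ hξ => by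
    have := hball (y := ξ) (by rw [Real.dist_0_eq_abs]; exact hξ.trans_lt hδ.2)
    rw [inversionFun, this, inversionFun, mul_pow, ← Complex.exp_nat_mul, sub_eq_add_neg,
      Complex.exp_add]
    have e : -(Complex.I * (k : ℂ) * ((ξ + ξ₀ : ℝ) : ℂ)) =
        -(Complex.I * (k : ℂ) * (ξ₀ : ℂ)) + -(Complex.I * ((k : ℝ) : ℂ) * (ξ : ℂ)) := by
      push_cast; ring
    rw [e, Complex.exp_add]
    ring
  have hshift : ∫ ξ in ξ₀ - δ..ξ₀ + δ, inversionFun ν n k ξ =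
      ∫ ξ in -δ..δ, inversionFun ν n k (ξ + ξ₀) := by
    rw [intervalIntegral.integral_comp_add_right (inversionFun ν n k)]
    congr 1 <;> ring
  have hc' : Continuous fun ξ => inversionFun ν n k (ξ + ξ₀) := by fun_prop
  have hleft : ∫ ξ in -δ..0, inversionFun ν n k (ξ + ξ₀) =
      ∫ ξ in (0 : ℝ)..δ, inversionFun ν n k (-ξ + ξ₀) := by
    rw [intervalIntegral.integral_comp_neg fun ξ => inversionFun ν n k (ξ + ξ₀), neg_zero]
  rw [hshift, ← intervalIntegral.integral_add_adjacent_intervals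
    (hc'.intervalIntegrable (-δ) 0) (hc'.intervalIntegrable 0 δ), hleft, mul_add,
    ← intervalIntegral.integral_const_mul, ← intervalIntegral.integral_const_mul, add_comm]
  congr 1
  · refine intervalIntegral.integral_congr fun ξ hξ => ?_
    rw [uIcc_of_le hδ.1.le] at hξ
    exact hval ξ (by rw [abs_of_nonneg hξ.1]; exact hξ.2)
  · refine intervalIntegral.integral_congr fun ξ hξ => ?_
    rw [uIcc_of_le hδ.1.le] at hξ
    rw [hval (-ξ) (by rw [abs_neg, abs_of_nonneg hξ.1]; exact hξ.2)]
    push_cast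
    ring_nf

open Classical in
/-- Contribution of a neighbourhood of `ξ₀` to the inversion formula. -/
theorem eventually_norm_integral_inversionFun_sub_le (hν : Continuous ν) (h1 : ‖ν ξ₀‖ = 1)
    {a : ℝ} {b : ℂ} {m₀ m : ℕ} (h : HasLocalForm (localLog ν ξ₀) a b m₀) (hm : m₀ ≤ m) (a' : ℝ) :
    ∀ᶠ δ in 𝓝[>] (0 : ℝ), ∀ X ε : ℝ, 0 < ε → ∀ᶠ n : ℕ in atTop, ∀ (x : ℝ) (k : ℤ), |x| ≤ X →
      |(k : ℝ) - (n * a' + x / scale m n)| ≤ 1 →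
      ‖(∫ ξ in ξ₀ - δ..ξ₀ + δ, inversionFun ν n k ξ) -
        (if m₀ = m ∧ a = a' then
          2 * (Real.pi : ℂ) * (scale m n * inversionFun ν n k ξ₀ * attractor m b x) else 0)‖ ≤
        ε * scale m n := by
  obtain ⟨_, _, _, _, _, hp⟩ := h.exists_isOneSidedPhase
  obtain ⟨_, _, _, _, _, hq⟩ := h.comp_neg.exists_isOneSidedPhase
  filter_upwards [integral_inversionFun_eq hν h1, hp.eventually_norm_integral_sub_le hm a',
    hq.eventually_norm_integral_sub_le hm (-a')] with δ heq hP hQ X ε hε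
  filter_upwards [hP X (ε / 2) (half_pos hε), hQ X (ε / 2) (half_pos hε)] with n hPn hQn x k hx hk
  have b1 := hPn x k hx hk
  -- On the left side the reflection changes the signs of the drift, of `x` and of `k`, so the
  -- closeness condition is preserved.
  have b2 := hQn (-x) (-k) (by rwa [abs_neg]) (by
    rw [← abs_neg]
    convert hk using 2
    ring)
  rw [heq]
  have hnorm : ‖inversionFun ν n k ξ₀‖ = 1 := by rw [norm_inversionFun, h1, one_pow]
  have hT : (if m₀ = m ∧ a = a' then
      2 * (Real.pi : ℂ) * (scale m n * inversionFun ν n k ξ₀ * attractor m b x) else 0) =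
      inversionFun ν n k ξ₀ * (scale m n * (if m₀ = m ∧ a = a' then halfAttractor m b x else 0) +
        scale m n * (if m₀ = m ∧ -a = -a' then halfAttractor m ((-1) ^ m₀ * b) (-x) else 0)) := by
    simp only [neg_inj]
    split_ifs with hcase
    · obtain ⟨rfl, -⟩ := hcase
      rw [attractor_eq h.two_le h.b_ne h.re_nonneg h.comp_neg.re_nonneg]
      have hpi : (Real.pi : ℂ) ≠ 0 := Complex.ofReal_ne_zero.mpr Real.pi_ne_zero
      field_simp
    · simp
  rw [hT, ← mul_sub, norm_mul, hnorm, one_mul, add_sub_add_comm]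
  push_cast at b1 b2 ⊢
  refine (norm_add_le _ _).trans ?_
  linarith

end LocalIntegral

/-- Exponential smallness away from the points where `|ν| = 1`. -/
theorem eventually_norm_setIntegral_inversionFun_le {ν : ℝ → ℂ} (hν : Continuous ν) {K s : Set ℝ}
    (hK : IsCompact K) (hs : s ⊆ K) (hlt : ∀ ξ ∈ K, ‖ν ξ‖ < 1) {m : ℕ} (hm : 1 < m) {ε : ℝ}
    (hε : 0 < ε) : ∀ᶠ n : ℕ in atTop, ∀ k : ℤ,
      ‖∫ ξ in s, inversionFun ν n k ξ‖ ≤ ε * scale m n := by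
  obtain ⟨ρ, hρ0, hρ1, hρ⟩ : ∃ ρ : ℝ, 0 ≤ ρ ∧ ρ < 1 ∧ ∀ ξ ∈ K, ‖ν ξ‖ ≤ ρ := by
    rcases K.eq_empty_or_nonempty with rfl | hne
    · exact ⟨0, le_rfl, one_pos, by simp⟩
    · obtain ⟨z, hz, hmax⟩ := hK.exists_isMaxOn hne hν.norm.continuousOn
      exact ⟨‖ν z‖, norm_nonneg _, hlt z hz, hmax⟩
  have hsK : volume s < ⊤ := (measure_mono hs).trans_lt hK.measure_lt_top
  set V := volume.real s + 1
  have hV : 0 < V := by positivity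
  have hlim := tendsto_self_mul_const_pow_of_lt_one hρ0 hρ1
  -- Since `n ρⁿ → 0`, the integral is eventually at most `1 / n`, which is `o(n^(-1/m))` as `m >
  -- 1`.
  filter_upwards [hlim.eventually_le_const (div_pos one_pos hV),
    eventually_scale_le one_ne_zero hm hε, eventually_gt_atTop 0] with n h1 h2 h3 k
  have hn : (0 : ℝ) < n := Nat.cast_pos.mpr h3
  refine le_trans ?_ h2
  have := norm_setIntegral_le_of_norm_le_const (f := inversionFun ν n k) hsK (C := ρ ^ n)
    fun ξ hξ => by
      rw [norm_inversionFun]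
      exact pow_le_pow_left₀ (norm_nonneg _) (hρ ξ (hs hξ)) n
  refine this.trans ?_
  rw [scale_one, le_div_iff₀ hn]
  calc ρ ^ n * volume.real s * n = n * ρ ^ n * volume.real s := by ring
    _ ≤ 1 / V * V := mul_le_mul h1 (by simp [V]) (by positivity) (by positivity)
    _ = 1 := one_div_mul_cancel hV.ne'

/-! ### Decomposition of a period and the local limit theorem. -/

section Assembly

theorem eventually_disjoint_and_subset (F : Finset ℝ) {c d : ℝ} (hF : ∀ ξ ∈ F, ξ ∈ Ioo c d) :
    ∀ᶠ δ in 𝓝[>] (0 : ℝ),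
      (∀ ξ ∈ F, Ioc (ξ - δ) (ξ + δ) ⊆ Ioc c d) ∧
      (F : Set ℝ).Pairwise (Function.onFun Disjoint fun ξ => Ioc (ξ - δ) (ξ + δ)) := by
  refine Eventually.and ((Filter.eventually_all_finset F).mpr fun ξ hξ => ?_) ?_
  · have h1 : 0 < min (ξ - c) (d - ξ) := lt_min (sub_pos.mpr (hF ξ hξ).1) (sub_pos.mpr (hF ξ hξ).2)
    filter_upwards [Ioo_mem_nhdsGT h1] with δ hδ
    have h2 := hδ.2.le.trans (min_le_left _ _)
    have h3 := hδ.2.le.trans (min_le_right _ _)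
    exact Ioc_subset_Ioc (by linarith) (by linarith)
  · have : ∀ᶠ δ in 𝓝[>] (0 : ℝ), ∀ ξ ∈ F, ∀ ζ ∈ F, ξ ≠ ζ → 2 * δ < |ξ - ζ| := by
      refine (Filter.eventually_all_finset F).mpr fun ξ _ =>
        (Filter.eventually_all_finset F).mpr fun ζ _ => ?_
      by_cases hne : ξ = ζ
      · exact Eventually.of_forall fun _ h => absurd hne h
      · have hpos : 0 < |ξ - ζ| / 2 := half_pos (abs_pos.mpr (sub_ne_zero.mpr hne))
        filter_upwards [Ioo_mem_nhdsGT hpos] with δ hδ _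
        linarith [hδ.2]
    filter_upwards [this] with δ hδ ξ hξ ζ hζ hne
    refine Set.disjoint_left.mpr fun y hy hy' => ?_
    have h1 := hδ ξ hξ ζ hζ hne
    have h2 : |ξ - ζ| ≤ 2 * δ := abs_le.mpr ⟨by linarith [hy.1, hy.2, hy'.1, hy'.2],
      by linarith [hy.1, hy.2, hy'.1, hy'.2]⟩
    linarith

variable {φ : ℤ → ℂ}

theorem norm_fourierT_le_one (hsup : IsLUB (Set.range fun ξ : ℝ => ‖fourierT φ ξ‖) 1) (ξ : ℝ) :
    ‖fourierT φ ξ‖ ≤ 1 :=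
  hsup.1 ⟨ξ, rfl⟩

/-- A left neighbourhood of `ξ₀` would lie in the finite set `Ω`. The left side is taken because
`ξ₀` may be `π`. -/
theorem not_eventually_norm_eq_one (hφ : AdmissibleSupport φ) {ξ₀ : ℝ}
    (h : ξ₀ ∈ unitPoints (fourierT φ)) : ¬ ∀ᶠ ξ in 𝓝 ξ₀, ‖fourierT φ ξ‖ = 1 := by
  intro hev
  obtain ⟨r, hr, hball⟩ := Metric.eventually_nhds_iff.mp hev
  have hsub : Ioo (max (ξ₀ - r) (-Real.pi)) ξ₀ ⊆ unitPoints (fourierT φ) := fun ξ hξ => by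
    have h1 := (le_max_left _ _).trans_lt hξ.1
    have h2 := (le_max_right _ _).trans_lt hξ.1
    refine ⟨⟨h2, hξ.2.le.trans h.1.2⟩, hball ?_⟩
    rw [Real.dist_eq, abs_sub_comm, abs_of_pos (sub_pos.mpr hξ.2)]
    linarith
  exact Set.Ioo_infinite (max_lt (by linarith) h.1.1) ((finite_unitPoints hφ).subset hsub)

theorem hasLocalForm_fourierT (hφ : AdmissibleSupport φ)
    (hsup : IsLUB (Set.range fun ξ : ℝ => ‖fourierT φ ξ‖) 1) {ξ₀ : ℝ}
    (h : ξ₀ ∈ unitPoints (fourierT φ)) :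
    HasLocalForm (localLog (fourierT φ) ξ₀) (drift (fourierT φ) ξ₀) (coeff (fourierT φ) ξ₀)
      (order (fourierT φ) ξ₀) :=
  hasLocalForm_localLog (analyticAt_fourierT hφ.1 ξ₀) h.2 (norm_fourierT_le_one hsup)
    (not_eventually_norm_eq_one hφ h)

theorem order_le_maxOrder (hφ : AdmissibleSupport φ) {ξ₀ : ℝ}
    (h : ξ₀ ∈ unitPoints (fourierT φ)) :
    order (fourierT φ) ξ₀ ≤ maxOrder (fourierT φ) :=
  le_csSup ((finite_unitPoints hφ).image _).bddAbove (mem_image_of_mem _ h)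

/-- A period on which all points with `|φ̂| = 1` are interior. -/
theorem exists_window (hφ : AdmissibleSupport φ) : ∃ c : ℝ,
    (∀ ξ ∈ unitPoints (fourierT φ), ξ ∈ Ioo c (c + 2 * Real.pi)) ∧
    ∀ ξ ∈ Icc c (c + 2 * Real.pi), ‖fourierT φ ξ‖ = 1 → ξ ∈ unitPoints (fourierT φ) := by
  -- `c` lies slightly above `-π` and below all of `Ω`, so that `π` becomes interior. Points of `(π,
  -- c + 2π]` translate into `(-π, c]`, which `Ω` does not meet.
  have hev : ∀ᶠ c in 𝓝[>] (-Real.pi), ∀ ξ ∈ unitPoints (fourierT φ), c < ξ := by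
    refine ((finite_unitPoints hφ).eventually_all).mpr fun ξ hξ => ?_
    filter_upwards [Ioo_mem_nhdsGT hξ.1.1] with c hc using hc.2
  have hpos := Real.pi_pos
  obtain ⟨c, hc, hpi', hcp⟩ := (hev.and (Ioo_mem_nhdsGT (neg_lt_self hpos))).exists
  refine ⟨c, fun ξ hξ => ⟨hc ξ hξ, by linarith [hξ.1.2]⟩, fun ξ hξ h1 => ?_⟩
  rcases le_or_gt ξ Real.pi with h | h
  · exact ⟨⟨hpi'.trans_le hξ.1, h⟩, h1⟩
  · by_cases hmem : ξ - 2 * Real.pi ∈ unitPoints (fourierT φ)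
    · linarith [hc _ hmem, hξ.2]
    · refine absurd ⟨⟨by linarith, by linarith [hξ.2]⟩, ?_⟩ hmem
      rw [(periodic_fourierT φ).sub_eq, h1]

open Classical in
/-- The local limit theorem, for arbitrary integers close to `a' n + x n ^ (1 / m)`. -/
theorem eventually_norm_convPow_sub_le (hφ : AdmissibleSupport φ)
    (hsup : IsLUB (Set.range fun ξ : ℝ => ‖fourierT φ ξ‖) 1) (a' X : ℝ) {ε : ℝ} (hε : 0 < ε) :
    ∀ᶠ n : ℕ in atTop, ∀ (x : ℝ) (k : ℤ), |x| ≤ X →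
      |(k : ℝ) - (n * a' + x / scale (maxOrder (fourierT φ)) n)| ≤ 1 →
      ‖convPow φ n k - ∑ ξ ∈ (finite_unitPoints hφ).toFinset,
        (if order (fourierT φ) ξ = maxOrder (fourierT φ) ∧ drift (fourierT φ) ξ = a' then
          scale (maxOrder (fourierT φ)) n * inversionFun (fourierT φ) n k ξ *
            attractor (maxOrder (fourierT φ)) (coeff (fourierT φ) ξ) x else 0)‖ ≤
        ε * scale (maxOrder (fourierT φ)) n := by
  set ν := fourierT φ with hν
  set m := maxOrder ν with hm
  set F := (finite_unitPoints hφ).toFinset with hF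
  have hFmem : ∀ ξ, ξ ∈ F ↔ ξ ∈ unitPoints ν := fun ξ => Finite.mem_toFinset _
  have hνc : Continuous ν := continuous_fourierT hφ.1
  obtain ⟨ζ, hζ⟩ := nonempty_unitPoints hφ hsup
  have hm1 : 1 < m := lt_of_lt_of_le (by linarith [(hasLocalForm_fourierT hφ hsup hζ).two_le])
    (order_le_maxOrder hφ hζ)
  obtain ⟨c, hwin, hunit⟩ := exists_window hφ
  have hloc : ∀ᶠ δ in 𝓝[>] (0 : ℝ), ∀ ξ ∈ F, ∀ X ε : ℝ, 0 < ε → ∀ᶠ n : ℕ in atTop,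
      ∀ (x : ℝ) (k : ℤ), |x| ≤ X → |(k : ℝ) - (n * a' + x / scale m n)| ≤ 1 →
      ‖(∫ u in ξ - δ..ξ + δ, inversionFun ν n k u) -
        (if order ν ξ = m ∧ drift ν ξ = a' then
          2 * (Real.pi : ℂ) * (scale m n * inversionFun ν n k ξ * attractor m (coeff ν ξ) x)
          else 0)‖ ≤ ε * scale m n :=
    (Filter.eventually_all_finset F).mpr fun ξ hξ => by
      have hξ' := (hFmem ξ).mp hξ
      exact eventually_norm_integral_inversionFun_sub_le hνc hξ'.2
        (hasLocalForm_fourierT hφ hsup hξ') (order_le_maxOrder hφ hξ') a'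
  obtain ⟨δ, ⟨hlocδ, hsubδ, hdisj⟩, hδ⟩ := ((hloc.and (eventually_disjoint_and_subset F
    fun ξ hξ => hwin ξ ((hFmem ξ).mp hξ))).and self_mem_nhdsWithin).exists
  have hδ0 : 0 < δ := hδ
  set W := Ioc c (c + 2 * Real.pi) with hW
  set U := ⋃ ξ ∈ F, Ioc (ξ - δ) (ξ + δ) with hU
  have hUW : U ⊆ W := iUnion₂_subset hsubδ
  have hUmeas : MeasurableSet U := F.measurableSet_biUnion fun _ _ => measurableSet_Ioc
  -- Removing open intervals keeps `K` compact. It contains `W \ U`, and `|ν| < 1` on it.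
  set K := Icc c (c + 2 * Real.pi) \ ⋃ ξ ∈ F, Ioo (ξ - δ) (ξ + δ) with hKdef
  have hK : IsCompact K := isCompact_Icc.diff (isOpen_biUnion fun _ _ => isOpen_Ioo)
  have hsK : W \ U ⊆ K := sdiff_subset_sdiff Ioc_subset_Icc_self
    (iUnion₂_mono fun _ _ => Ioo_subset_Ioc_self)
  have hlt : ∀ ξ ∈ K, ‖ν ξ‖ < 1 := fun ξ hξ => by
    refine lt_of_le_of_ne (norm_fourierT_le_one hsup ξ) fun h => hξ.2 ?_
    have : ξ ∈ F := (hFmem ξ).mpr (hunit ξ hξ.1 h)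
    exact mem_biUnion this ⟨by linarith, by linarith⟩
  -- One share of the error goes to each point of `Ω` and one to the remainder; the factor `1 / 2π`
  -- is bounded by `1`.
  set ε' := ε / (F.card + 1) with hε'
  have hε'0 : 0 < ε' := by positivity
  have hall : ∀ᶠ n : ℕ in atTop, ∀ ξ ∈ F, ∀ (x : ℝ) (k : ℤ), |x| ≤ X →
      |(k : ℝ) - (n * a' + x / scale m n)| ≤ 1 →
      ‖(∫ u in ξ - δ..ξ + δ, inversionFun ν n k u) -
        (if order ν ξ = m ∧ drift ν ξ = a' then
          2 * (Real.pi : ℂ) * (scale m n * inversionFun ν n k ξ * attractor m (coeff ν ξ) x)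
          else 0)‖ ≤ ε' * scale m n :=
    (Filter.eventually_all_finset F).mpr fun ξ hξ => hlocδ ξ hξ X ε' hε'0
  filter_upwards [hall, eventually_norm_setIntegral_inversionFun_le hνc hK hsK hlt hm1 hε'0,
    eventually_gt_atTop 0] with n h1 h2 h3 x k hx hk
  have hfc := continuous_inversionFun hνc n k
  have hper : Function.Periodic (inversionFun ν n k) (2 * Real.pi) := fun ξ => by
    have := exp_int_mul_add_two_pi k ξ
    simp only [inversionFun, Complex.exp_neg, this, hν, periodic_fourierT φ ξ]
  have hinv : convPow φ n k = 1 / (2 * (Real.pi : ℂ)) *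
      ((∑ ξ ∈ F, ∫ u in ξ - δ..ξ + δ, inversionFun ν n k u) +
        ∫ u in W \ U, inversionFun ν n k u) := by
    rw [convPow_eq_integral hφ.1]
    congr 1
    change ∫ u in (-Real.pi)..Real.pi, inversionFun ν n k u = _
    have e1 := hper.intervalIntegral_add_eq (-Real.pi) c
    rw [show -Real.pi + 2 * Real.pi = Real.pi by ring] at e1
    have hWint : IntegrableOn (inversionFun ν n k) W :=
      (hfc.integrableOn_Icc).mono_set Ioc_subset_Icc_self
    rw [e1, intervalIntegral.integral_of_le (by linarith [Real.pi_pos]),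
      ← integral_inter_add_sdiff hUmeas hWint, inter_eq_right.mpr hUW,
      integral_biUnion_finset F (fun _ _ => measurableSet_Ioc) hdisj
        fun _ _ => hfc.integrableOn_Icc.mono_set Ioc_subset_Icc_self]
    congr 1
    refine Finset.sum_congr rfl fun ξ _ => ?_
    rw [intervalIntegral.integral_of_le (by linarith)]
  have hpi : (2 * (Real.pi : ℂ)) ≠ 0 := by simp [Real.pi_ne_zero]
  set T : ℝ → ℂ := fun ξ => scale m n * inversionFun ν n k ξ * attractor m (coeff ν ξ) x with hT
  have hdiff : convPow φ n k - ∑ ξ ∈ F, (if order ν ξ = m ∧ drift ν ξ = a' then T ξ else 0) =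
      1 / (2 * (Real.pi : ℂ)) *
      ((∑ ξ ∈ F, ((∫ u in ξ - δ..ξ + δ, inversionFun ν n k u) -
        (if order ν ξ = m ∧ drift ν ξ = a' then 2 * (Real.pi : ℂ) * T ξ else 0))) +
        ∫ u in W \ U, inversionFun ν n k u) := by
    rw [hinv, Finset.sum_sub_distrib]
    have : ∑ ξ ∈ F, (if order ν ξ = m ∧ drift ν ξ = a' then 2 * (Real.pi : ℂ) * T ξ else 0) =
        2 * (Real.pi : ℂ) * ∑ ξ ∈ F, (if order ν ξ = m ∧ drift ν ξ = a' then T ξ else 0) := by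
      rw [Finset.mul_sum]
      exact Finset.sum_congr rfl fun ξ _ => by split_ifs <;> simp
    rw [this]
    field_simp
    ring
  rw [hdiff, norm_mul]
  have hpre : ‖1 / (2 * (Real.pi : ℂ))‖ ≤ 1 := by
    rw [norm_div, norm_one, norm_mul, Complex.norm_real, Real.norm_of_nonneg Real.pi_pos.le,
      Complex.norm_ofNat]
    exact div_le_one_of_le₀ (by linarith [Real.pi_gt_three]) (by positivity)
  refine (mul_le_of_le_one_left (norm_nonneg _) hpre).trans ((norm_add_le _ _).trans ?_)
  have hsum := (norm_sum_le F _).trans (Finset.sum_le_sum fun ξ hξ => h1 ξ hξ x k hx hk)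
  rw [Finset.sum_const, nsmul_eq_mul] at hsum
  refine (add_le_add hsum (h2 k)).trans (le_of_eq ?_)
  rw [hε']
  field_simp

end Assembly

end

end ConvPowers

open ConvPowers in
theorem theorem1p3 (φ : ℤ → ℂ) (hφ : AdmissibleSupport φ)
    (hsup : IsLUB (Set.range fun ξ : ℝ => ‖fourierT φ ξ‖) 1) :
    -- the constants are well defined
    (unitPoints (fourierT φ)).Finite ∧ (unitPoints (fourierT φ)).Nonempty ∧
    (∀ ξ₀ ∈ unitPoints (fourierT φ),
      2 ≤ order (fourierT φ) ξ₀ ∧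
      coeff (fourierT φ) ξ₀ ≠ 0 ∧
      0 ≤ (coeff (fourierT φ) ξ₀).re ∧
      (Odd (order (fourierT φ) ξ₀) → (coeff (fourierT φ) ξ₀).re = 0) ∧
      (fun ξ : ℝ => localLog (fourierT φ) ξ₀ ξ -
          (Complex.I * (drift (fourierT φ) ξ₀ : ℂ) * (ξ : ℂ) -
            coeff (fourierT φ) ξ₀ * (ξ : ℂ) ^ order (fourierT φ) ξ₀))
        =o[𝓝 0] fun ξ : ℝ => ξ ^ order (fourierT φ) ξ₀) ∧
    -- the integrals that define the attractors converge
    (∀ ξ₀ ∈ maxPoints (fourierT φ), ∀ x : ℝ,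
      Tendsto (attractorTrunc (maxOrder (fourierT φ)) (coeff (fourierT φ) ξ₀) x)
        (atBot ×ˢ atTop)
        (𝓝 (attractor (maxOrder (fourierT φ)) (coeff (fourierT φ) ξ₀) x))) ∧
    -- the local limit theorem on the packet of each drift constant
    ∀ ξq ∈ maxPoints (fourierT φ), ∀ K : Set ℝ, IsCompact K → ∀ ε : ℝ, 0 < ε →
      ∃ N : ℕ, ∀ n : ℕ, N ≤ n → ∀ x ∈ K,
        ‖convPow φ n
            ⌊drift (fourierT φ) ξq * (n : ℝ) + x * (n : ℝ) ^ (1 / (maxOrder (fourierT φ) : ℝ))⌋ -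
          ∑ᶠ ξ ∈ {ξ ∈ maxPoints (fourierT φ) | drift (fourierT φ) ξ = drift (fourierT φ) ξq},
            (((n : ℝ) ^ (-(1 / (maxOrder (fourierT φ) : ℝ))) : ℝ) : ℂ) *
              Complex.exp (-(Complex.I *
                (⌊drift (fourierT φ) ξq * (n : ℝ) +
                    x * (n : ℝ) ^ (1 / (maxOrder (fourierT φ) : ℝ))⌋ : ℂ) * (ξ : ℂ))) *
              fourierT φ ξ ^ n *
              attractor (maxOrder (fourierT φ)) (coeff (fourierT φ) ξ) x‖
          ≤ ε * (n : ℝ) ^ (-(1 / (maxOrder (fourierT φ) : ℝ))) := by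
  have hfin := finite_unitPoints hφ
  refine ⟨hfin, nonempty_unitPoints hφ hsup, fun ξ₀ hξ₀ => ?_, fun ξ₀ hξ₀ x => ?_,
    fun ξq hξq K hK ε hε => ?_⟩
  · have h := hasLocalForm_fourierT hφ hsup hξ₀
    refine ⟨h.two_le, h.b_ne, h.re_nonneg, fun hodd => le_antisymm ?_ h.re_nonneg, h.isLittleO⟩
    have := h.comp_neg.re_nonneg
    rw [hodd.neg_one_pow, neg_one_mul, Complex.neg_re] at this
    linarith
  · have h := hasLocalForm_fourierT hφ hsup hξ₀.1
    rw [hξ₀.2] at h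
    -- `attractor` is a `limUnder`, so the existence of some limit suffices.
    exact tendsto_nhds_limUnder
      ⟨_, tendsto_attractorTrunc h.two_le h.b_ne h.re_nonneg h.comp_neg.re_nonneg x⟩
  · obtain ⟨X, hX⟩ := hK.isBounded.exists_norm_le
    obtain ⟨N, hN⟩ := eventually_atTop.mp
      (eventually_norm_convPow_sub_le hφ hsup (drift (fourierT φ) ξq) X hε)
    refine ⟨N, fun n hn x hx => ?_⟩
    set y := drift (fourierT φ) ξq * (n : ℝ) +
      x * (n : ℝ) ^ (1 / (maxOrder (fourierT φ) : ℝ)) with hy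
    -- Rounding enters only through this bound by `1`, which is negligible against `n^(1/m)`.
    have hfloor : |(⌊y⌋ : ℝ) - (n * drift (fourierT φ) ξq +
        x / scale (maxOrder (fourierT φ)) n)| ≤ 1 := by
      rw [div_scale, mul_comm (n : ℝ), ← hy, abs_le]
      constructor <;> linarith [Int.floor_le y, Int.lt_floor_add_one y]
    have hset : {ξ ∈ maxPoints (fourierT φ) | drift (fourierT φ) ξ = drift (fourierT φ) ξq} =
        ((hfin.toFinset.filter fun ξ => order (fourierT φ) ξ = maxOrder (fourierT φ) ∧
          drift (fourierT φ) ξ = drift (fourierT φ) ξq : Finset ℝ) : Set ℝ) := by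
      ext ξ
      simp [maxPoints, and_assoc]
    rw [hset, finsum_mem_coe_finset, Finset.sum_filter]
    have key := hN n hn x ⌊y⌋ (hX x hx) hfloor
    simp only [scale, inversionFun, ← mul_assoc] at key
    convert key
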